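/- Let $G=(V,E)$ be a finite connected simple undirected graph on $n=|V|$ vertices, with positive edge weights $w_G:E\to\mathbb{R}_{>0}$, and let $H,s$ be positive integers. Let $Z$ be the simplicial complex of dimension $H$ on the vertex set $V\times[s]$, consisting of all subsets of its $H$-dimensional faces, which are the sets $\sigma=\{(v_1,b_1),\dots,(v_{H+1},b_{H+1})\}$ such that $b_1,\dots,b_{H+1}$ are pairwise distinct and $\{v_1,\dots,v_{H+1}\}=\{u,v\}$ for some edge $\{u,v\}\in E$. Write $Z(k)$ for the set of faces with $k+1$ elements. Give an $H$-dimensional face $\sigma$ as above the weight $$m(\sigma)=\frac{w_G(\{u,v\})}{\binom{H-1}{j-1}},\qquad j=|\{i:v_i=u\}|,$$ (this is symmetric in $u$ and $v$) and extend $m$ to all faces by the balance condition $m(\sigma)=\sum_{\sigma\subset\tau\in Z(k+1)}m(\tau)$ for $\sigma\in Z(k)$, $-1\le k<H$. For $0\le k\le H-1$ let $W_k^{\uparrow\downarrow}$ be the $k$-dimensional up-down walk operator, the $Z(k)\times Z(k)$ matrix $W_k^{\uparrow\downarrow}=W^{\downarrow}_{k+1}W^{\uparrow}_k$, where for $\sigma\in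 Z(k)$ and $\tau\in Z(k+1)$ one sets $W^{\uparrow}_k(\tau,\sigma)=m(\tau)/m(\sigma)$ and $W^{\downarrow}_{k+1}(\sigma,\tau)=\frac1{k+2}$ if $\sigma\subset\tau$, and both entries are $0$ otherwise. Let $W_G=M_GD_G^{-1}$ be the random walk matrix of $G$, where $M_G$ is the weighted adjacency matrix and $D_G$ the diagonal matrix of weighted degrees. For a square matrix $W$ with real eigenvalues $\omega_1(W)\ge\omega_2(W)\ge\cdots$ (listed with multiplicity) let $\nu_2(W)=1-\omega_2(W)$ be its spectral gap, and let $\nu_2(G)=\nu_2(W_G)$. If $n\ge4$, $H\ge2$ and $s\ge2H$, then for every $0\le k\le H-1$, $$\nu_2(W_k^{\uparrow\downarrow})\;\ge\;\frac{\nu_2(G)}{\bigl(\sum_{\ell=1}^{H}1/\ell\bigr)(k+2)(k+1)}\;\ge\;\frac{\nu_2(G)}{(1+\log H)(k+2)(k+1)}.$$ -/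

import Mathlib

/-! ### Spectral gap of a real matrix -/

/-- The second largest eigenvalue `ω₂(A)` of a square real matrix with real spectrum: the entry in
position 2 of the list of its eigenvalues (the roots of its characteristic polynomial, with
multiplicity) in decreasing order. All the matrices used below are walk matrices of reversible
chains, so that they have a full set of real eigenvalues
(see `card_roots_charpoly_of_reversible`). -/
noncomputable def secondEigenvalue {ι : Type*} [Fintype ι] [DecidableEq ι]
    (A : Matrix ι ι ℝ) : ℝ :=
  (A.charpoly.roots.sort (fun a b => a ≥ b)).getD 1 0

/-- The spectral gap `ν₂(A) = 1 - ω₂(A)`. -/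
noncomputable def spectralGap {ι : Type*} [Fintype ι] [DecidableEq ι]
    (A : Matrix ι ι ℝ) : ℝ :=
  1 - secondEigenvalue A

/-! ### Weighted graphs -/

namespace SimpleGraph

variable {V : Type*} [Fintype V] [DecidableEq V]

open Classical in
/-- The weighted adjacency matrix `M_G` of a graph `G` with edge weights `w`. -/
noncomputable def weightedAdjMatrix (G : SimpleGraph V) (w : Sym2 V → ℝ) : Matrix V V ℝ :=
  Matrix.of fun u v => if G.Adj u v then w s(u, v) else 0

/-- The diagonal matrix `D_G` of weighted degrees. -/
noncomputable def weightedDegMatrix (G : SimpleGraph V) (w : Sym2 V → ℝ) : Matrix V V ℝ :=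
  Matrix.diagonal fun v => ∑ u, G.weightedAdjMatrix w u v

/-- The random walk matrix `W_G = M_G D_G⁻¹`. -/
noncomputable def walkMatrix (G : SimpleGraph V) (w : Sym2 V → ℝ) : Matrix V V ℝ :=
  G.weightedAdjMatrix w * (G.weightedDegMatrix w)⁻¹

end SimpleGraph

/-! ### Simplicial complexes, weights and high-order walks -/

/-- A finite abstract simplicial complex, the empty face being allowed. -/
structure FinComplex (α : Type*) where
  faces : Finset (Finset α)
  down_closed : ∀ ⦃σ τ : Finset α⦄, σ ⊆ τ → τ ∈ faces → σ ∈ faces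

namespace FinComplex

variable {α : Type*} [DecidableEq α]

/-- The set of faces with exactly `c` elements, that is, of dimension `c - 1`. -/
def facesOfCard (X : FinComplex α) (c : ℕ) : Finset (Finset α) :=
  X.faces.filter fun σ => σ.card = c

/-- `X(k)`, the set of `k`-dimensional faces, for `k ≥ 0`. -/
def facesOfDim (X : FinComplex α) (k : ℕ) : Finset (Finset α) :=
  X.facesOfCard (k + 1)

/-- The complex generated by a family of faces: all subsets of members of the family. -/
def generatedBy (F : Finset (Finset α)) : FinComplex α where
  faces := F.biUnion Finset.powerset
  down_closed := by
    intro σ τ h hτ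
    simp only [Finset.mem_biUnion, Finset.mem_powerset] at hτ ⊢
    obtain ⟨ρ, hρ, hτρ⟩ := hτ
    exact ⟨ρ, hρ, h.trans hτρ⟩

/-- `m` is a balanced weight function on the `H`-dimensional complex `X`: for every face `σ` of
dimension `-1 ≤ k < H`, `m σ` is the sum of the weights of the `(k+1)`-dimensional faces
containing it. -/
def IsBalanced (X : FinComplex α) (H : ℕ) (m : Finset α → ℝ) : Prop :=
  ∀ c < H + 1, ∀ σ ∈ X.facesOfCard c, m σ = ∑ τ ∈ X.facesOfCard (c + 1) with σ ⊂ τ, m τ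

/-- Propagation of a weight function downwards by `d` levels. -/
noncomputable def propagateAux (X : FinComplex α) (top : Finset α → ℝ) :
    ℕ → Finset α → ℝ
  | 0, σ => top σ
  | d + 1, σ => ∑ τ ∈ X.facesOfCard (σ.card + 1) with σ ⊂ τ, X.propagateAux top d τ

/-- The weight function on the `H`-dimensional complex `X` that is obtained by propagating the
weights `top` of the `H`-dimensional faces downwards (see `propagate_top` and
`isBalanced_propagate`). -/
noncomputable def propagate (X : FinComplex α) (H : ℕ) (top : Finset α → ℝ)
    (σ : Finset α) : ℝ :=
  X.propagateAux top (H + 1 - σ.card) σ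

theorem propagate_top (X : FinComplex α) (H : ℕ) (top : Finset α → ℝ) {σ : Finset α}
    (hσ : σ ∈ X.facesOfDim H) : X.propagate H top σ = top σ := by
  have h : σ.card = H + 1 := (Finset.mem_filter.mp hσ).2
  simp [propagate, h, propagateAux]

theorem isBalanced_propagate (X : FinComplex α) (H : ℕ) (top : Finset α → ℝ) :
    X.IsBalanced H (X.propagate H top) := by
  intro c hc σ hσ
  have h : σ.card = c := (Finset.mem_filter.mp hσ).2
  have e : H + 1 - σ.card = (H - c) + 1 := by omega
  rw [propagate, e, propagateAux, h]
  refine Finset.sum_congr rfl fun τ hτ => ?_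
  have h' : τ.card = c + 1 := (Finset.mem_filter.mp (Finset.mem_filter.mp hτ).1).2
  rw [propagate, h', Nat.add_sub_add_right]

/-- The up-step operator `W↑_k`, with rows indexed by `X(k+1)` and columns by `X(k)`. -/
noncomputable def upStep (X : FinComplex α) (m : Finset α → ℝ) (k : ℕ) :
    Matrix (X.facesOfDim (k + 1)) (X.facesOfDim k) ℝ :=
  Matrix.of fun τ σ => if (σ : Finset α) ⊂ τ then m τ / m σ else 0

/-- The down-step operator from `X(k+1)` to `X(k)` (that is, `W↓_{k+1}`), with rows indexed by
`X(k)` and columns by `X(k+1)`: one of the `k + 2` elements is removed uniformly at random. -/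
noncomputable def downStep (X : FinComplex α) (k : ℕ) :
    Matrix (X.facesOfDim k) (X.facesOfDim (k + 1)) ℝ :=
  Matrix.of fun τ σ => if (τ : Finset α) ⊂ σ then 1 / ((k : ℝ) + 2) else 0

/-- The `k`-dimensional up-down walk operator: an up-step followed by a down-step. -/
noncomputable def upDownWalk (X : FinComplex α) (m : Finset α → ℝ) (k : ℕ) :
    Matrix (X.facesOfDim k) (X.facesOfDim k) ℝ :=
  X.downStep k * X.upStep m k

end FinComplex

/-! ### The complex `Z` -/

namespace ZComplex

variable {V : Type*} [Fintype V] [DecidableEq V]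

open Classical in
/-- `Z(H)`: the sets of `H + 1` elements of `V × [s]` whose first coordinates form exactly the two
endpoints of an edge of `G` and whose second coordinates are pairwise distinct. -/
noncomputable def topFaces (G : SimpleGraph V) (H s : ℕ) : Finset (Finset (V × Fin s)) :=
  Finset.univ.filter fun σ => σ.card = H + 1 ∧
    (∃ u v, G.Adj u v ∧ σ.image Prod.fst = {u, v}) ∧ Set.InjOn Prod.snd (σ : Set (V × Fin s))

/-- The `H`-dimensional complex `Z`. -/
noncomputable def complex (G : SimpleGraph V) (H s : ℕ) : FinComplex (V × Fin s) :=
  FinComplex.generatedBy (topFaces G H s)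

/-- The number of elements of `σ` whose first coordinate is `u`. -/
def fiberCard {s : ℕ} (σ : Finset (V × Fin s)) (u : V) : ℕ :=
  (σ.filter fun p => p.1 = u).card

open Classical in
/-- The weight `w(uv) / binom(H-1, j-1)` of an `H`-dimensional face whose first coordinates form
the edge `uv`, where `j` of its elements lie over `u`. The value does not depend on which endpoint
of the edge is called `u` (see `topWeight_eq`). -/
noncomputable def topWeight (G : SimpleGraph V) (w : Sym2 V → ℝ) (H s : ℕ)
    (σ : Finset (V × Fin s)) : ℝ :=
  if h : ∃ e : V × V, G.Adj e.1 e.2 ∧ σ.image Prod.fst = {e.1, e.2} then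
    w s(h.choose.1, h.choose.2) / ((H - 1).choose (fiberCard σ h.choose.1 - 1) : ℝ)
  else 0

/-- The balanced weight function `m` on `Z`. -/
noncomputable def weight (G : SimpleGraph V) (w : Sym2 V → ℝ) (H s : ℕ) :
    Finset (V × Fin s) → ℝ :=
  (complex G H s).propagate H (topWeight G w H s)

theorem topWeight_eq (G : SimpleGraph V) (w : Sym2 V → ℝ) {H s : ℕ}
    {σ : Finset (V × Fin s)} (hσ : σ.card = H + 1) {u v : V} (huv : G.Adj u v)
    (him : σ.image Prod.fst = {u, v}) :
    topWeight G w H s σ = w s(u, v) / ((H - 1).choose (fiberCard σ u - 1) : ℝ) := by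
  have h : ∃ e : V × V, G.Adj e.1 e.2 ∧ σ.image Prod.fst = {e.1, e.2} := ⟨(u, v), huv, him⟩
  have key : ∀ a b : V, ({a, b} : Finset V) = {u, v} → a ≠ b →
      (a = u ∧ b = v) ∨ (a = v ∧ b = u) := by
    intro a b hab hne
    have ha : a ∈ ({u, v} : Finset V) := hab ▸ (by simp)
    have hb : b ∈ ({u, v} : Finset V) := hab ▸ (by simp)
    simp only [Finset.mem_insert, Finset.mem_singleton] at ha hb
    grind
  have hsum : fiberCard σ u + fiberCard σ v = H + 1 := by
    have h1 := Finset.card_eq_sum_card_image Prod.fst σ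
    rw [him, Finset.sum_pair huv.ne, hσ] at h1
    exact h1.symm
  have hpos : ∀ x ∈ ({u, v} : Finset V), 1 ≤ fiberCard σ x := by
    intro x hx
    rw [← him] at hx
    obtain ⟨p, hp, rfl⟩ := Finset.mem_image.mp hx
    exact Finset.card_pos.mpr ⟨p, Finset.mem_filter.mpr ⟨hp, rfl⟩⟩
  have hu := hpos u (by simp)
  have hv := hpos v (by simp)
  rw [topWeight, dif_pos h]
  have hc := h.choose_spec
  rcases key _ _ (hc.2.symm.trans him) hc.1.ne with ⟨h1, h2⟩ | ⟨h1, h2⟩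
  · rw [h1, h2]
  · rw [h1, h2, Sym2.eq_swap]
    congr 2
    rw [← Nat.choose_symm (by omega)]
    congr 1
    omega

end ZComplex

/-- A walk matrix that is reversible with respect to positive weights has a full set of real
eigenvalues. -/
theorem card_roots_charpoly_of_reversible {ι : Type*} [Fintype ι] [DecidableEq ι]
    (A : Matrix ι ι ℝ) (p : ι → ℝ) (hp : ∀ i, 0 < p i)
    (hA : ∀ i j, A i j * p j = A j i * p i) :
    A.charpoly.roots.card = Fintype.card ι := by
  let q : ι → ℝ := fun i => Real.sqrt (p i)
  have hq : ∀ i, q i ≠ 0 := fun i => (Real.sqrt_pos.mpr (hp i)).ne'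
  have hqq : ∀ i, q i * q i = p i := fun i => Real.mul_self_sqrt (hp i).le
  let U : (Matrix ι ι ℝ)ˣ :=
    ⟨Matrix.diagonal q, Matrix.diagonal fun i => (q i)⁻¹, by simp [hq], by simp [hq]⟩
  let B : Matrix ι ι ℝ := U⁻¹.val * A * U.val
  have hB : B.IsHermitian := by
    ext i j
    have e : ∀ i j, B i j = (q i)⁻¹ * A i j * q j := fun i j => by
      change (Matrix.diagonal (fun i => (q i)⁻¹) * A * Matrix.diagonal q) i j = _
      simp
    rw [Matrix.conjTranspose_apply, e, e, star_trivial]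
    have := hA i j
    rw [← hqq, ← hqq] at this
    field_simp [hq i, hq j]
    linarith
  have hchar : B.charpoly = A.charpoly := by
    have := Matrix.charpoly_units_conj' U A
    rwa [← Matrix.coe_units_inv] at this
  rw [← hchar, hB.roots_charpoly_eq_eigenvalues]
  simp

/-!
The proof bounds the gap of the high-order walks by the gaps of the links.

All matrices involved are reversible, so their second eigenvalues are governed by Poincaré
inequalities: `secondEigenvalue_le` turns such an inequality into a bound on the second eigenvalue,
and `quadratic_form_le_secondEigenvalue` gives back an inequality for the walk on `G`.

Garland's decomposition (`upDownForm_eq_sum_links`) writes the quadratic form of an up-down walk as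
a sum over the links of the faces one dimension below. If the 1-skeletons of the links of all faces
with `c` elements have gap `ν` and the up-down walk on the faces with `c` elements has gap `γ`,
then the up-down walk one level above has gap at least `ν γ (c + 1) / (c + 2)`
(`HasUpDownGap.succ`). Apart from the local gap, the step uses that the up-down walk and the
down-up walk above it have the same nonzero spectrum, in the form of the Cauchy-Schwarz
inequality `HasUpDownGap.norm_average_le`.

The weights of `Z` can be computed (`faceWeight_edge`, `faceWeight_vertex`): up to a factor that
depends only on the number of elements, a face with `i ≥ 1` elements over `u` and `j ≥ 1` over `v`
has weight `w(uv) (i - 1)! (j - 1)!`, and a face with `c` elements over `u` alone has weight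
`deg(u) (c - 1)! (1 / c + ⋯ + 1 / H)`. Hence the 1-skeleton of each link is the product of a small
weighted graph and a complete graph on the unused colours, and as there are many colours the
negative eigenvalues of the small graph do no harm (`tensor_complete_form_le`). The small graph is
* for a face with `c` elements over both ends of an edge, a Pólya urn on two vertices,
  with gap `c / (c + 1)`;
* for a face with `c ≥ 1` elements over one vertex, a star with loops, with gap `c / (c + 1)`;
* for the empty face, `G` with loops that make up all but the fraction `1 / (1 + 1 / 2 + ⋯ + 1 / H)`
  of the degrees, so that its gap is `ν₂(G)` times this fraction.
In the last case the bounds on `n`, `H` and `s` are needed to control the negative eigenvalues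
(`ZComplex.hasLinkGap_empty`). The product of these gaps telescopes to the claim.
-/

/-! ### The second eigenvalue of a reversible walk matrix -/

/-- Eigenfunctions of a reversible matrix, orthonormal for the inner product weighted by `p`. The
eigenvalue `μ i₀` is a largest one, and `μ i₁` is the second largest. -/
theorem exists_eigenfunctions_of_reversible {ι : Type*} [Fintype ι] [DecidableEq ι]
    (A : Matrix ι ι ℝ) (p : ι → ℝ) (hp : ∀ i, 0 < p i)
    (hA : ∀ i j, A i j * p j = A j i * p i) (hι : 2 ≤ Fintype.card ι) :
    ∃ (v : ι → ι → ℝ) (μ : ι → ℝ) (i₀ i₁ : ι), i₀ ≠ i₁ ∧ μ i₁ = secondEigenvalue A ∧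
      μ i₁ ≤ μ i₀ ∧ (∀ i, i ≠ i₀ → μ i ≤ μ i₁) ∧
      (∀ i j, ∑ x, p x * v i x * v j x = if i = j then 1 else 0) ∧
      (∀ i y, ∑ x, A x y * v i x = μ i * v i y) ∧
      ∀ f : ι → ℝ, ∀ x, f x = ∑ i, (∑ y, p y * f y * v i y) * v i x := by
  -- conjugation by the square roots of the weights makes `A` symmetric
  let q : ι → ℝ := fun i => Real.sqrt (p i)
  have hq : ∀ i, q i ≠ 0 := fun i => (Real.sqrt_pos.mpr (hp i)).ne'
  have hqq : ∀ i, q i * q i = p i := fun i => Real.mul_self_sqrt (hp i).le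
  let U : (Matrix ι ι ℝ)ˣ :=
    ⟨Matrix.diagonal q, Matrix.diagonal fun i => (q i)⁻¹, by simp [hq], by simp [hq]⟩
  let B : Matrix ι ι ℝ := U⁻¹.val * A * U.val
  have e : ∀ i j, B i j = (q i)⁻¹ * A i j * q j := fun i j => by
    change (Matrix.diagonal (fun i => (q i)⁻¹) * A * Matrix.diagonal q) i j = _
    simp
  have hsymm : ∀ i j, B i j = B j i := by
    intro i j
    rw [e, e]
    have := hA i j
    rw [← hqq, ← hqq] at this
    field_simp [hq i, hq j]
    linarith
  have hB : B.IsHermitian := by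
    ext i j
    rw [Matrix.conjTranspose_apply, star_trivial, hsymm]
  have hchar : B.charpoly = A.charpoly := by
    have := Matrix.charpoly_units_conj' U A
    rwa [← Matrix.coe_units_inv] at this
  let E : Fin (Fintype.card ι) ≃ ι := Fintype.equivOfCardEq (Fintype.card_fin _)
  have hEv : ∀ i, hB.eigenvalues (E i) = hB.eigenvalues₀ i := fun i => by
    simp [Matrix.IsHermitian.eigenvalues, E]
  have hEv' : ∀ i, hB.eigenvalues i = hB.eigenvalues₀ (E.symm i) := fun i => by
    rw [← hEv]; simp
  have hsort := hB.sort_roots_charpoly_eq_eigenvalues₀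
  have hsecond : hB.eigenvalues₀ ⟨1, hι⟩ = secondEigenvalue A := by
    have hre : (RCLike.re : ℝ → ℝ) = id := by ext x; simp
    rw [hchar, hre, Multiset.map_id] at hsort
    rw [secondEigenvalue, hsort, List.getD_eq_getElem _ _ (by rw [List.length_ofFn]; exact hι)]
    simp
  let b := hB.eigenvectorBasis
  refine ⟨fun i x => b i x / q x, hB.eigenvalues, E ⟨0, by omega⟩, E ⟨1, hι⟩, ?_, ?_, ?_, ?_, ?_,
    ?_, ?_⟩
  · simp
  · rw [hEv, hsecond]
  · rw [hEv, hEv]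
    exact hB.eigenvalues₀_antitone (by simp [Fin.le_def])
  · intro i hi
    rw [hEv, hEv' i]
    refine hB.eigenvalues₀_antitone ?_
    rw [Fin.le_def]
    have : E.symm i ≠ ⟨0, by omega⟩ := fun h => hi (by rw [← h]; simp)
    rw [Ne, Fin.ext_iff] at this
    simp only at this ⊢
    omega
  · intro i j
    have h := orthonormal_iff_ite.mp b.orthonormal j i
    rw [PiLp.inner_apply] at h
    simp only [RCLike.inner_apply, conj_trivial] at h
    rw [show (if i = j then (1 : ℝ) else 0) = if j = i then 1 else 0 by simp [eq_comm], ← h]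
    refine Finset.sum_congr rfl fun x _ => ?_
    rw [← hqq]
    field_simp [hq x]
  · intro i y
    have h := congrFun (hB.mulVec_eigenvectorBasis i) y
    simp only [Matrix.mulVec, dotProduct, Pi.smul_apply, smul_eq_mul] at h
    change ∑ x, A x y * (b i x / q x) = hB.eigenvalues i * (b i y / q y)
    rw [← mul_div_assoc, ← h, Finset.sum_div]
    refine Finset.sum_congr rfl fun x _ => ?_
    rw [hsymm, e]
    field_simp [hq x, hq y]
    simp [b]
  · intro f x
    let F : EuclideanSpace ℝ ι := WithLp.toLp 2 fun x => f x * q x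
    have h := congrArg (fun z : EuclideanSpace ℝ ι => z x) (b.sum_repr' F)
    simp only [WithLp.ofLp_sum, Finset.sum_apply, PiLp.smul_apply, smul_eq_mul,
      PiLp.inner_apply, RCLike.inner_apply, conj_trivial] at h
    change _ = f x * q x at h
    rw [eq_comm, ← mul_right_cancel_iff_of_pos (Real.sqrt_pos.mpr (hp x))]
    change _ = f x * q x
    rw [← h, Finset.sum_mul]
    refine Finset.sum_congr rfl fun i _ => ?_
    rw [mul_assoc, div_mul_cancel₀]
    swap
    · exact hq x
    congr 1
    refine Finset.sum_congr rfl fun y _ => ?_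
    change _ = f y * q y * _
    rw [← hqq]
    field_simp [hq y]

theorem quadratic_form_eq_of_transpose_apply {ι : Type*} [Fintype ι] {A : Matrix ι ι ℝ} {p : ι → ℝ}
    {f g : ι → ℝ} (hg : ∀ y, ∑ x, A x y * f x = g y) :
    ∑ x, ∑ y, A x y * p y * f x * f y = ∑ y, p y * g y * f y := by
  rw [Finset.sum_comm]
  refine Finset.sum_congr rfl fun y _ => ?_
  rw [← hg, Finset.mul_sum, Finset.sum_mul]
  exact Finset.sum_congr rfl fun x _ => by ring

/-- The easy half of the min-max principle: the span of two top eigenfunctions contains a nonzero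
function of mean zero. -/
theorem secondEigenvalue_le {ι : Type*} [Fintype ι] [DecidableEq ι]
    (A : Matrix ι ι ℝ) (p : ι → ℝ) (hp : ∀ i, 0 < p i)
    (hA : ∀ i j, A i j * p j = A j i * p i) (hι : 2 ≤ Fintype.card ι) (c : ℝ)
    (h : ∀ f : ι → ℝ, ∑ x, p x * f x = 0 →
      ∑ x, ∑ y, A x y * p y * f x * f y ≤ c * ∑ x, p x * f x ^ 2) :
    secondEigenvalue A ≤ c := by
  obtain ⟨v, μ, i₀, i₁, hne, h₁, h₀, -, hv, hAv, -⟩ :=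
    exists_eigenfunctions_of_reversible A p hp hA hι
  obtain ⟨a, b, hab, hpos⟩ : ∃ a b : ℝ, a * ∑ x, p x * v i₀ x + b * ∑ x, p x * v i₁ x = 0 ∧
      0 < a ^ 2 + b ^ 2 := by
    by_cases hz : ∑ x, p x * v i₀ x = 0
    · exact ⟨1, 0, by simp [hz], by norm_num⟩
    · refine ⟨∑ x, p x * v i₁ x, -∑ x, p x * v i₀ x, by ring, ?_⟩
      have := sq_nonneg (∑ x, p x * v i₁ x)
      have : 0 < (∑ x, p x * v i₀ x) ^ 2 := by positivity
      nlinarith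
  have key : ∀ r t : ℝ, ∑ x, p x * (r * v i₀ x + t * v i₁ x) * (a * v i₀ x + b * v i₁ x) =
      r * a + t * b := by
    intro r t
    have e : ∀ x, p x * (r * v i₀ x + t * v i₁ x) * (a * v i₀ x + b * v i₁ x) =
        r * a * (p x * v i₀ x * v i₀ x) + r * b * (p x * v i₀ x * v i₁ x) +
          t * a * (p x * v i₁ x * v i₀ x) + t * b * (p x * v i₁ x * v i₁ x) := fun x => by ring
    simp only [e, Finset.sum_add_distrib, ← Finset.mul_sum, hv, if_neg hne, if_neg hne.symm]
    simp
  have hf := h (fun x => a * v i₀ x + b * v i₁ x) (by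
    simp only [mul_add, Finset.sum_add_distrib]
    rw [← hab, Finset.mul_sum, Finset.mul_sum]
    congr 1 <;> exact Finset.sum_congr rfl fun x _ => by ring)
  rw [quadratic_form_eq_of_transpose_apply
    (g := fun y => a * μ i₀ * v i₀ y + b * μ i₁ * v i₁ y) (fun y => by
      simp only [mul_add, Finset.sum_add_distrib]
      rw [mul_assoc, ← hAv, mul_assoc b, ← hAv, Finset.mul_sum, Finset.mul_sum]
      congr 1 <;> exact Finset.sum_congr rfl fun x _ => by ring), key] at hf
  have e : ∀ x, p x * (a * v i₀ x + b * v i₁ x) ^ 2 =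
      p x * (a * v i₀ x + b * v i₁ x) * (a * v i₀ x + b * v i₁ x) := fun x => by ring
  simp only [e, key] at hf
  rw [← h₁]
  by_contra hc
  push Not at hc
  nlinarith [mul_le_mul_of_nonneg_right h₀ (sq_nonneg a), mul_lt_mul_of_pos_right hc hpos]

/-- The quadratic form of a reversible stochastic matrix is dominated by the weighted norm. -/
theorem quadratic_form_le_of_stochastic {ι : Type*} [Fintype ι]
    (A : Matrix ι ι ℝ) (p : ι → ℝ) (hA0 : ∀ i j, 0 ≤ A i j * p j)
    (hA : ∀ i j, A i j * p j = A j i * p i) (hA1 : ∀ j, ∑ i, A i j = 1) (f : ι → ℝ) :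
    ∑ x, ∑ y, A x y * p y * f x * f y ≤ ∑ x, p x * f x ^ 2 := by
  have h1 : ∑ x, ∑ y, A x y * p y * f y ^ 2 = ∑ x, p x * f x ^ 2 := by
    rw [Finset.sum_comm]
    refine Finset.sum_congr rfl fun y _ => ?_
    rw [← Finset.sum_mul, ← Finset.sum_mul, hA1, one_mul]
  have h2 : ∑ x, ∑ y, A x y * p y * f x ^ 2 = ∑ x, p x * f x ^ 2 := by
    rw [Finset.sum_comm, ← h1]
    exact Finset.sum_congr rfl fun x _ => Finset.sum_congr rfl fun y _ => by rw [hA]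
  have h3 : 0 ≤ ∑ x, ∑ y, A x y * p y * (f x - f y) ^ 2 :=
    Finset.sum_nonneg fun x _ => Finset.sum_nonneg fun y _ => mul_nonneg (hA0 x y) (sq_nonneg _)
  have e : ∀ x y, A x y * p y * (f x - f y) ^ 2 = A x y * p y * f x ^ 2 + A x y * p y * f y ^ 2
      - 2 * (A x y * p y * f x * f y) := fun x y => by ring
  simp only [e, Finset.sum_sub_distrib, Finset.sum_add_distrib, ← Finset.mul_sum, h1, h2] at h3
  linarith

theorem secondEigenvalue_le_one_of_stochastic {ι : Type*} [Fintype ι] [DecidableEq ι]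
    (A : Matrix ι ι ℝ) (p : ι → ℝ) (hp : ∀ i, 0 < p i) (hA0 : ∀ i j, 0 ≤ A i j * p j)
    (hA : ∀ i j, A i j * p j = A j i * p i) (hA1 : ∀ j, ∑ i, A i j = 1)
    (hι : 2 ≤ Fintype.card ι) : secondEigenvalue A ≤ 1 :=
  secondEigenvalue_le A p hp hA hι 1 fun f _ => by
    rw [one_mul]; exact quadratic_form_le_of_stochastic A p hA0 hA hA1 f

/-- The Poincaré inequality. When the second eigenvalue is less than `1`, the constants
span the top eigenspace; otherwise the bound is `quadratic_form_le_of_stochastic`. -/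
theorem quadratic_form_le_secondEigenvalue {ι : Type*} [Fintype ι] [DecidableEq ι]
    (A : Matrix ι ι ℝ) (p : ι → ℝ) (hp : ∀ i, 0 < p i) (hA0 : ∀ i j, 0 ≤ A i j * p j)
    (hA : ∀ i j, A i j * p j = A j i * p i) (hA1 : ∀ j, ∑ i, A i j = 1)
    (hι : 2 ≤ Fintype.card ι) (f : ι → ℝ) (hf : ∑ x, p x * f x = 0) :
    ∑ x, ∑ y, A x y * p y * f x * f y ≤ secondEigenvalue A * ∑ x, p x * f x ^ 2 := by
  rcases le_or_gt 1 (secondEigenvalue A) with hge | hlt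
  · exact (quadratic_form_le_of_stochastic A p hA0 hA hA1 f).trans
      (le_mul_of_one_le_left (Finset.sum_nonneg fun x _ =>
        mul_nonneg (hp x).le (sq_nonneg _)) hge)
  obtain ⟨v, μ, i₀, i₁, hne, h₁, h₀, hle, hv, hAv, hrep⟩ :=
    exists_eigenfunctions_of_reversible A p hp hA hι
  have hconst : ∀ i, i ≠ i₀ → ∑ y, p y * v i y = 0 := by
    intro i hi
    have e1 : ∑ y, ∑ x, A x y * p y * v i x = μ i * ∑ y, p y * v i y := by
      rw [Finset.mul_sum]
      refine Finset.sum_congr rfl fun y _ => ?_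
      rw [show μ i * (p y * v i y) = p y * (μ i * v i y) by ring, ← hAv, Finset.mul_sum]
      exact Finset.sum_congr rfl fun x _ => by ring
    have e2 : ∑ y, ∑ x, A x y * p y * v i x = ∑ y, p y * v i y := by
      rw [Finset.sum_comm]
      refine Finset.sum_congr rfl fun x _ => ?_
      simp only [hA x]
      rw [← Finset.sum_mul, ← Finset.sum_mul, hA1, one_mul]
    have : (1 - μ i) * ∑ y, p y * v i y = 0 := by linarith
    rcases mul_eq_zero.mp this with h | h
    · have := hle i hi
      linarith
    · exact h
  have hone : ∀ x, 1 = (∑ y, p y * v i₀ y) * v i₀ x := by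
    intro x
    have h := hrep (fun _ => 1) x
    simp only [mul_one] at h
    rwa [Finset.sum_eq_single i₀ (fun i _ hi => by rw [hconst i hi, zero_mul]) (by simp)] at h
  set c : ι → ℝ := fun i => ∑ y, p y * f y * v i y with hc
  have hc0 : c i₀ = 0 := by
    have : (∑ y, p y * v i₀ y) * c i₀ = 0 := by
      rw [← hf, hc, Finset.mul_sum]
      refine Finset.sum_congr rfl fun y _ => ?_
      rw [show (∑ y, p y * v i₀ y) * (p y * f y * v i₀ y) =
        (p y * f y) * ((∑ y, p y * v i₀ y) * v i₀ y) by ring, ← hone, mul_one]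
    rcases mul_eq_zero.mp this with h | h
    · have := hone i₀
      rw [h, zero_mul] at this
      exact absurd this one_ne_zero
    · exact h
  have hform : ∀ a : ι → ℝ, ∑ y, p y * (∑ i, a i * v i y) * f y = ∑ i, a i * c i := by
    intro a
    simp only [hc, Finset.mul_sum, Finset.sum_mul]
    rw [Finset.sum_comm]
    exact Finset.sum_congr rfl fun i _ => Finset.sum_congr rfl fun y _ => by ring
  rw [quadratic_form_eq_of_transpose_apply (g := fun y => ∑ i, (μ i * c i) * v i y) (fun y => ?_),
    hform]
  · have e : ∑ x, p x * f x ^ 2 = ∑ i, c i * c i := by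
      rw [← hform]
      refine Finset.sum_congr rfl fun x _ => ?_
      rw [← hrep f x]
      ring
    rw [e, Finset.mul_sum, ← h₁]
    refine Finset.sum_le_sum fun i _ => ?_
    by_cases hi : i = i₀
    · rw [hi, hc0]; simp
    · rw [mul_assoc]
      exact mul_le_mul_of_nonneg_right (hle i hi) (mul_self_nonneg _)
  · have e : ∀ x, A x y * f x = ∑ i, c i * (A x y * v i x) := fun x => by
      conv_lhs => rw [hrep f x]
      rw [Finset.mul_sum]
      exact Finset.sum_congr rfl fun i _ => by ring
    simp only [e]
    rw [Finset.sum_comm]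
    refine Finset.sum_congr rfl fun i _ => ?_
    rw [← Finset.mul_sum, hAv]
    ring

/-! ### From local spectral gaps to gaps of the high-order walks -/

/-- Counting pairs of a set and an element of it by removing that element. -/
theorem sum_powersetCard_succ_erase {α : Type*} [Fintype α] [DecidableEq α] (c : ℕ)
    (F : Finset α → α → ℝ) :
    ∑ τ ∈ Finset.powersetCard (c + 1) Finset.univ, ∑ x ∈ τ, F (τ.erase x) x =
      ∑ ρ ∈ Finset.powersetCard c Finset.univ, ∑ x ∈ ρᶜ, F ρ x := by
  rw [Finset.sum_sigma', Finset.sum_sigma']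
  refine Finset.sum_bij' (fun z _ => ⟨z.1.erase z.2, z.2⟩) (fun z _ => ⟨insert z.2 z.1, z.2⟩)
    ?_ ?_ ?_ ?_ ?_
  · rintro ⟨τ, x⟩ h
    simp only [Finset.mem_sigma, Finset.mem_powersetCard_univ] at h
    simp [Finset.mem_sigma, Finset.card_erase_of_mem h.2, h.1]
  · rintro ⟨ρ, x⟩ h
    simp only [Finset.mem_sigma, Finset.mem_powersetCard_univ, Finset.mem_compl] at h
    simp [Finset.mem_sigma, Finset.card_insert_of_notMem h.2, h.1]
  · rintro ⟨τ, x⟩ h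
    simp only [Finset.mem_sigma] at h
    simp [Finset.insert_erase h.2]
  · rintro ⟨ρ, x⟩ h
    simp only [Finset.mem_sigma, Finset.mem_compl] at h
    simp [Finset.erase_insert h.2]
  · rintro ⟨τ, x⟩ h
    rfl

/-- The quadratic form of `c + 1` times the up-down walk on the sets with `c` elements, for the
inner product given by the weight `m`. -/
noncomputable def upDownForm {α : Type*} [Fintype α] [DecidableEq α] (m : Finset α → ℝ) (c : ℕ)
    (f : Finset α → ℝ) : ℝ :=
  ∑ τ ∈ Finset.powersetCard (c + 1) Finset.univ, m τ * (∑ x ∈ τ, f (τ.erase x)) ^ 2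

/-- The up-down walk on the sets with `c` elements satisfies a Poincaré inequality with
constant `γ`. -/
def HasUpDownGap {α : Type*} [Fintype α] [DecidableEq α] (m : Finset α → ℝ) (c : ℕ)
    (γ : ℝ) : Prop :=
  ∀ f : Finset α → ℝ, ∑ σ ∈ Finset.powersetCard c Finset.univ, m σ * f σ = 0 →
    upDownForm m c f ≤
      ((c : ℝ) + 1) * (1 - γ) * ∑ σ ∈ Finset.powersetCard c Finset.univ, m σ * f σ ^ 2

/-- The walk on the 1-skeleton of the link of `ρ` satisfies a Poincaré inequality with
constant `ν`. -/
def HasLinkGap {α : Type*} [Fintype α] [DecidableEq α] (m : Finset α → ℝ) (ρ : Finset α)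
    (ν : ℝ) : Prop :=
  ∀ g : α → ℝ, ∑ y ∈ ρᶜ, m (insert y ρ) * g y = 0 →
    ∑ y ∈ ρᶜ, ∑ x ∈ (insert y ρ)ᶜ, m (insert x (insert y ρ)) * g y * g x ≤
      (1 - ν) * ∑ y ∈ ρᶜ, m (insert y ρ) * g y ^ 2

/-- Garland's decomposition of the up-down form into the forms of the links. -/
theorem upDownForm_eq_sum_links {α : Type*} [Fintype α] [DecidableEq α] (m : Finset α → ℝ) (c : ℕ)
    (hbal : ∀ σ : Finset α, σ.card = c + 1 → m σ = ∑ x ∈ σᶜ, m (insert x σ))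
    (f : Finset α → ℝ) :
    upDownForm m (c + 1) f = ∑ σ ∈ Finset.powersetCard (c + 1) Finset.univ, m σ * f σ ^ 2 +
      ∑ ρ ∈ Finset.powersetCard c Finset.univ, ∑ y ∈ ρᶜ, ∑ x ∈ (insert y ρ)ᶜ,
        m (insert x (insert y ρ)) * f (insert y ρ) * f (insert x ρ) := by
  have h1 : upDownForm m (c + 1) f = ∑ σ ∈ Finset.powersetCard (c + 1) Finset.univ,
      ∑ x ∈ σᶜ, m (insert x σ) * f σ * (∑ y ∈ insert x σ, f ((insert x σ).erase y)) := by
    rw [← sum_powersetCard_succ_erase (c + 1) fun σ x =>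
      m (insert x σ) * f σ * (∑ y ∈ insert x σ, f ((insert x σ).erase y))]
    refine Finset.sum_congr rfl fun τ _ => ?_
    rw [sq, Finset.sum_mul, Finset.mul_sum]
    refine Finset.sum_congr rfl fun x hx => ?_
    rw [Finset.insert_erase hx]
    ring
  have h2 : ∀ σ ∈ Finset.powersetCard (c + 1) (Finset.univ : Finset α),
      ∑ x ∈ σᶜ, m (insert x σ) * f σ * (∑ y ∈ insert x σ, f ((insert x σ).erase y)) =
      m σ * f σ ^ 2 + ∑ y ∈ σ, ∑ x ∈ (insert y (σ.erase y))ᶜ,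
        m (insert x (insert y (σ.erase y))) * f (insert y (σ.erase y)) *
          f (insert x (σ.erase y)) := by
    intro σ hσ
    have e : ∀ y ∈ σ, insert y (σ.erase y) = σ := fun y hy => Finset.insert_erase hy
    rw [show ∑ y ∈ σ, ∑ x ∈ (insert y (σ.erase y))ᶜ,
        m (insert x (insert y (σ.erase y))) * f (insert y (σ.erase y)) *
          f (insert x (σ.erase y)) = ∑ y ∈ σ, ∑ x ∈ σᶜ, m (insert x σ) * f σ *
          f (insert x (σ.erase y)) from Finset.sum_congr rfl fun y hy => by rw [e y hy],
      Finset.sum_comm, hbal σ (Finset.mem_powersetCard_univ.mp hσ), Finset.sum_mul,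
      ← Finset.sum_add_distrib]
    refine Finset.sum_congr rfl fun x hx => ?_
    rw [Finset.mem_compl] at hx
    rw [Finset.sum_insert hx, Finset.erase_insert hx, mul_add, Finset.mul_sum]
    congr 1
    · ring
    · refine Finset.sum_congr rfl fun y hy => ?_
      rw [Finset.erase_insert_of_ne (by rintro rfl; exact hx hy)]
  rw [h1, Finset.sum_congr rfl h2, Finset.sum_add_distrib]
  congr 1
  exact sum_powersetCard_succ_erase c fun ρ y => ∑ x ∈ (insert y ρ)ᶜ,
        m (insert x (insert y ρ)) * f (insert y ρ) * f (insert x ρ)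

/-- The Poincaré inequality in a link, for functions that need not have mean zero. -/
theorem HasLinkGap.form_le {α : Type*} [Fintype α] [DecidableEq α] {m : Finset α → ℝ}
    {ρ : Finset α} {ν : ℝ} (h : HasLinkGap m ρ ν) (hm : ∀ σ, 0 ≤ m σ)
    (hρ : m ρ = ∑ x ∈ ρᶜ, m (insert x ρ))
    (hbal : ∀ y ∈ ρᶜ, m (insert y ρ) = ∑ x ∈ (insert y ρ)ᶜ, m (insert x (insert y ρ)))
    (g : α → ℝ) :
    ∑ y ∈ ρᶜ, ∑ x ∈ (insert y ρ)ᶜ, m (insert x (insert y ρ)) * g y * g x ≤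
      (1 - ν) * ∑ y ∈ ρᶜ, m (insert y ρ) * g y ^ 2 +
        ν * (m ρ * ((∑ y ∈ ρᶜ, m (insert y ρ) * g y) / m ρ) ^ 2) := by
  set a := (∑ y ∈ ρᶜ, m (insert y ρ) * g y) / m ρ with ha
  have hmean : ∑ y ∈ ρᶜ, m (insert y ρ) * g y = a * m ρ := by
    by_cases h0 : m ρ = 0
    · rw [h0, mul_zero]
      rw [h0, eq_comm, Finset.sum_eq_zero_iff_of_nonneg fun x _ => hm _] at hρ
      exact Finset.sum_eq_zero fun y hy => by rw [hρ y hy, zero_mul]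
    · rw [ha, div_mul_cancel₀ _ h0]
  have h1 := h (fun y => g y - a) (by
    simp only [mul_sub, Finset.sum_sub_distrib, ← Finset.sum_mul]
    rw [hmean, ← hρ]
    ring)
  have e1 : ∑ y ∈ ρᶜ, m (insert y ρ) * (g y - a) ^ 2 =
      ∑ y ∈ ρᶜ, m (insert y ρ) * g y ^ 2 - a ^ 2 * m ρ := by
    have : ∀ y, m (insert y ρ) * (g y - a) ^ 2 = m (insert y ρ) * g y ^ 2
      - 2 * a * (m (insert y ρ) * g y) + a ^ 2 * m (insert y ρ) := fun y => by ring
    simp only [this, Finset.sum_add_distrib, Finset.sum_sub_distrib, ← Finset.mul_sum]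
    rw [hmean, ← hρ]
    ring
  have e2 : ∑ y ∈ ρᶜ, ∑ x ∈ (insert y ρ)ᶜ, m (insert x (insert y ρ)) * (g y - a) * (g x - a) =
      ∑ y ∈ ρᶜ, ∑ x ∈ (insert y ρ)ᶜ, m (insert x (insert y ρ)) * g y * g x - a ^ 2 * m ρ := by
    have hl : ∑ y ∈ ρᶜ, ∑ x ∈ (insert y ρ)ᶜ, m (insert x (insert y ρ)) * g y = a * m ρ := by
      rw [← hmean]
      refine Finset.sum_congr rfl fun y hy => ?_
      rw [← Finset.sum_mul, ← hbal y hy]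
    have hr : ∑ y ∈ ρᶜ, ∑ x ∈ (insert y ρ)ᶜ, m (insert x (insert y ρ)) * g x = a * m ρ := by
      rw [← hl, Finset.sum_comm' (t' := ρᶜ) (s' := fun x => (insert x ρ)ᶜ)]
      · refine Finset.sum_congr rfl fun y _ => Finset.sum_congr rfl fun x _ => ?_
        rw [Finset.insert_comm]
      · intro x y
        simp only [Finset.mem_compl, Finset.mem_insert]
        grind
    have hc : ∑ y ∈ ρᶜ, ∑ x ∈ (insert y ρ)ᶜ, m (insert x (insert y ρ)) = m ρ := by
      rw [hρ]
      exact Finset.sum_congr rfl fun y hy => (hbal y hy).symm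
    have : ∀ x y, m (insert x (insert y ρ)) * (g y - a) * (g x - a) =
        m (insert x (insert y ρ)) * g y * g x - a * (m (insert x (insert y ρ)) * g y)
        - a * (m (insert x (insert y ρ)) * g x) + a ^ 2 * m (insert x (insert y ρ)) :=
      fun x y => by ring
    simp only [this, Finset.sum_add_distrib, Finset.sum_sub_distrib, ← Finset.mul_sum]
    rw [hl, hr, hc]
    ring
  rw [e1, e2] at h1
  linarith

theorem hasUpDownGap_zero {α : Type*} [Fintype α] [DecidableEq α] (m : Finset α → ℝ)
    (hbal : m ∅ = ∑ x, m {x}) : HasUpDownGap m 0 1 := by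
  intro f hf
  simp only [Finset.powersetCard_zero, Finset.sum_singleton] at hf ⊢
  have h := sum_powersetCard_succ_erase (α := α) 0 fun ρ x => m (insert x ρ) * f ρ ^ 2
  simp only [Finset.powersetCard_zero, Finset.sum_singleton, Finset.compl_empty,
    insert_empty_eq] at h
  rw [← Finset.sum_mul, ← hbal] at h
  rw [sub_self, mul_zero, zero_mul, upDownForm]
  refine le_of_eq ?_
  rw [show (0 : ℝ) = m ∅ * f ∅ ^ 2 by rw [sq, ← mul_assoc, hf, zero_mul], ← h]
  refine Finset.sum_congr rfl fun τ hτ => ?_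
  obtain ⟨x, rfl⟩ := Finset.card_eq_one.mp (Finset.mem_powersetCard_univ.mp hτ)
  simp

/-- The averages `a` of a function `f` of mean zero over the sets containing a given set with `c`
elements: their norm is controlled by the gap of the up-down walk one level below. -/
theorem HasUpDownGap.norm_average_le {α : Type*} [Fintype α] [DecidableEq α] {m : Finset α → ℝ}
    {c : ℕ} {γ : ℝ} (h : HasUpDownGap m c γ) (hγ : γ ≤ 1) (hm : ∀ σ, 0 ≤ m σ)
    {f a : Finset α → ℝ}
    (ha : ∀ ρ : Finset α, ρ.card = c → m ρ * a ρ = ∑ y ∈ ρᶜ, m (insert y ρ) * f (insert y ρ))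
    (hf : ∑ σ ∈ Finset.powersetCard (c + 1) Finset.univ, m σ * f σ = 0) :
    ∑ ρ ∈ Finset.powersetCard c Finset.univ, m ρ * a ρ ^ 2 ≤
      ((c : ℝ) + 1) * (1 - γ) *
        ∑ σ ∈ Finset.powersetCard (c + 1) Finset.univ, m σ * f σ ^ 2 := by
  have hpair : ∀ b : Finset α → ℝ, ∑ ρ ∈ Finset.powersetCard c Finset.univ, m ρ * a ρ * b ρ =
      ∑ σ ∈ Finset.powersetCard (c + 1) Finset.univ, m σ * f σ * ∑ x ∈ σ, b (σ.erase x) := by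
    intro b
    have h1 : ∀ σ ∈ Finset.powersetCard (c + 1) (Finset.univ : Finset α),
        m σ * f σ * ∑ x ∈ σ, b (σ.erase x) =
        ∑ x ∈ σ, m (insert x (σ.erase x)) * f (insert x (σ.erase x)) * b (σ.erase x) := by
      intro σ _
      rw [Finset.mul_sum]
      exact Finset.sum_congr rfl fun x hx => by rw [Finset.insert_erase hx]
    rw [Finset.sum_congr rfl h1, sum_powersetCard_succ_erase c fun ρ x =>
      m (insert x ρ) * f (insert x ρ) * b ρ]
    refine Finset.sum_congr rfl fun ρ hρ => ?_
    rw [ha ρ (Finset.mem_powersetCard_univ.mp hρ), Finset.sum_mul]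
  have hmean : ∑ ρ ∈ Finset.powersetCard c Finset.univ, m ρ * a ρ = 0 := by
    have := hpair fun _ => 1
    simp only [mul_one, Finset.sum_const, nsmul_eq_mul] at this
    rw [this, ← mul_zero ((c : ℝ) + 1), ← hf, Finset.mul_sum]
    refine Finset.sum_congr rfl fun σ hσ => ?_
    rw [Finset.mem_powersetCard_univ.mp hσ]
    push_cast
    ring
  set A := ∑ ρ ∈ Finset.powersetCard c Finset.univ, m ρ * a ρ ^ 2 with hA
  set F := ∑ σ ∈ Finset.powersetCard (c + 1) Finset.univ, m σ * f σ ^ 2 with hF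
  have hA' : A = ∑ σ ∈ Finset.powersetCard (c + 1) Finset.univ,
      m σ * f σ * ∑ x ∈ σ, a (σ.erase x) := by
    rw [← hpair, hA]
    exact Finset.sum_congr rfl fun ρ _ => by ring
  have hgap := h a hmean
  rw [← hA] at hgap
  have hA0 : 0 ≤ A := Finset.sum_nonneg fun ρ _ => mul_nonneg (hm ρ) (sq_nonneg _)
  have hF0 : 0 ≤ F := Finset.sum_nonneg fun ρ _ => mul_nonneg (hm ρ) (sq_nonneg _)
  have hU0 : 0 ≤ upDownForm m c a :=
    Finset.sum_nonneg fun ρ _ => mul_nonneg (hm ρ) (sq_nonneg _)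
  -- Cauchy-Schwarz for the pairing of `f` with the sums of `a`
  have hCS : A ^ 2 ≤ F * upDownForm m c a := by
    rw [hA', hF, upDownForm]
    have := Finset.sum_mul_sq_le_sq_mul_sq (Finset.powersetCard (c + 1) Finset.univ)
      (fun σ => Real.sqrt (m σ) * f σ) (fun σ => Real.sqrt (m σ) * ∑ x ∈ σ, a (σ.erase x))
    have e : ∀ σ, Real.sqrt (m σ) * f σ * (Real.sqrt (m σ) * ∑ x ∈ σ, a (σ.erase x)) =
        m σ * f σ * ∑ x ∈ σ, a (σ.erase x) := fun σ => by
      nth_rw 3 [← Real.mul_self_sqrt (hm σ)]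
      ring
    simpa only [mul_pow, Real.sq_sqrt (hm _), e] using this
  rcases hA0.eq_or_lt with h0 | hpos
  · rw [← h0]
    exact mul_nonneg (mul_nonneg (by positivity) (by linarith)) hF0
  · have : A * A ≤ A * (((c : ℝ) + 1) * (1 - γ) * F) := by nlinarith
    exact le_of_mul_le_mul_left this hpos

/-- Local gaps multiply: a gap of the walk on the sets with `c` elements and a gap in all links of
such sets give a gap one level above. -/
theorem HasUpDownGap.succ {α : Type*} [Fintype α] [DecidableEq α] {m : Finset α → ℝ}
    {c : ℕ} {γ ν : ℝ} (h : HasUpDownGap m c γ) (hγ : γ ≤ 1) (hν : 0 ≤ ν) (hm : ∀ σ, 0 ≤ m σ)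
    (hbal : ∀ σ : Finset α, σ.card ≤ c + 1 → m σ = ∑ x ∈ σᶜ, m (insert x σ))
    (hlink : ∀ ρ : Finset α, ρ.card = c → HasLinkGap m ρ ν) :
    HasUpDownGap m (c + 1) (ν * γ * (((c : ℝ) + 1) / ((c : ℝ) + 2))) := by
  intro f hf
  set a : Finset α → ℝ := fun ρ => (∑ y ∈ ρᶜ, m (insert y ρ) * f (insert y ρ)) / m ρ with ha
  have hadd : ∀ ρ : Finset α, ρ.card = c → ∀ y ∈ ρᶜ, (insert y ρ).card = c + 1 :=
    fun ρ hρ y hy => by rw [Finset.card_insert_of_notMem (Finset.mem_compl.mp hy), hρ]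
  have hnorm := h.norm_average_le hγ hm (a := a) (fun ρ hρ => by
    by_cases h0 : m ρ = 0
    · have h1 := hbal ρ (by omega)
      rw [h0, eq_comm, Finset.sum_eq_zero_iff_of_nonneg fun x _ => hm _] at h1
      rw [h0, zero_mul, eq_comm]
      exact Finset.sum_eq_zero fun y hy => by rw [h1 y hy, zero_mul]
    · rw [ha, mul_div_cancel₀ _ h0]) hf
  have hloc : ∀ ρ ∈ Finset.powersetCard c (Finset.univ : Finset α), _ := fun ρ hρ =>
    (hlink ρ (Finset.mem_powersetCard_univ.mp hρ)).form_le hm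
      (hbal ρ (by rw [Finset.mem_powersetCard_univ.mp hρ]; omega))
      (fun y hy => hbal _ (hadd ρ (Finset.mem_powersetCard_univ.mp hρ) y hy).le)
      (fun y => f (insert y ρ))
  have hsum := Finset.sum_le_sum hloc
  rw [Finset.sum_add_distrib, ← Finset.mul_sum, ← Finset.mul_sum] at hsum
  have hF : ∑ ρ ∈ Finset.powersetCard c Finset.univ, ∑ y ∈ ρᶜ, m (insert y ρ) * f (insert y ρ) ^ 2
      = ((c : ℝ) + 1) * ∑ σ ∈ Finset.powersetCard (c + 1) Finset.univ, m σ * f σ ^ 2 := by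
    rw [← sum_powersetCard_succ_erase c fun ρ y => m (insert y ρ) * f (insert y ρ) ^ 2,
      Finset.mul_sum]
    refine Finset.sum_congr rfl fun σ hσ => ?_
    rw [Finset.sum_congr rfl fun x hx => by rw [Finset.insert_erase hx], Finset.sum_const,
      Finset.mem_powersetCard_univ.mp hσ, nsmul_eq_mul]
    push_cast
    rfl
  rw [hF] at hsum
  rw [upDownForm_eq_sum_links m c (fun σ hσ => hbal σ hσ.le)]
  have hmul := mul_le_mul_of_nonneg_left hnorm hν
  set F := ∑ σ ∈ Finset.powersetCard (c + 1) Finset.univ, m σ * f σ ^ 2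
  have e : (((c + 1 : ℕ) : ℝ) + 1) * (1 - ν * γ * (((c : ℝ) + 1) / ((c : ℝ) + 2))) * F =
      F + ((1 - ν) * (((c : ℝ) + 1) * F) + ν * (((c : ℝ) + 1) * (1 - γ) * F)) := by
    push_cast
    field_simp
    ring
  rw [e]
  linarith

/-! ### Links that are products with a complete graph on colours -/

/-- The gap of a tensor product of a weighted graph `N` with loops on `V` and the complete graph
on a set `T` of colours. A function is split into its average over the colours, for which the gap
of `N` is used, and a rest, on which the complete graph acts by `-1 / (|T| - 1)`, so that a lower
bound for the form of `N` suffices. -/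
theorem tensor_complete_form_le {V C : Type*} [Fintype V] [DecidableEq C]
    (N : V → V → ℝ) (d : V → ℝ) (hd : ∀ x, 0 ≤ d x) (T : Finset C) (hT : T.Nonempty) (ν β : ℝ)
    (hgap : ∀ h : V → ℝ, ∑ x, d x * h x = 0 →
      ∑ x, ∑ y, N x y * h x * h y ≤ (1 - ν) * ∑ x, d x * h x ^ 2)
    (hlow : ∀ h : V → ℝ, -β * ∑ x, d x * h x ^ 2 ≤ ∑ x, ∑ y, N x y * h x * h y)
    (hβ : β ≤ (1 - ν) * ((T.card : ℝ) - 1))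
    (g : V → C → ℝ) (hg : ∑ b ∈ T, ∑ x, d x * g x b = 0) :
    ∑ b ∈ T, ∑ x, ∑ b' ∈ T.erase b, ∑ y, N x y * g x b * g y b' ≤
      (1 - ν) * (((T.card : ℝ) - 1) * ∑ b ∈ T, ∑ x, d x * g x b ^ 2) := by
  set r : ℝ := (T.card : ℝ) with hr
  have hr1 : 1 ≤ r := by
    rw [hr]; exact_mod_cast hT.card_pos
  set S : V → ℝ := fun x => ∑ b ∈ T, g x b with hS
  have hA := hgap S (by
    rw [← hg, Finset.sum_comm]
    exact Finset.sum_congr rfl fun x _ => Finset.mul_sum _ _ _)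
  have hB := Finset.sum_le_sum fun b (_ : b ∈ T) => hlow fun x => g x b - S x / r
  rw [← Finset.mul_sum] at hB
  have e0 : ∀ x y, ∑ b ∈ T, (g x b - S x / r) * (g y b - S y / r) =
      ∑ b ∈ T, g x b * g y b - S x * S y / r := by
    intro x y
    have : ∀ b, (g x b - S x / r) * (g y b - S y / r) =
      g x b * g y b - S y / r * g x b - S x / r * g y b + S x * S y / r ^ 2 := fun b => by
      field_simp; ring
    simp only [this, Finset.sum_add_distrib, Finset.sum_sub_distrib, ← Finset.mul_sum,
      Finset.sum_const, nsmul_eq_mul, ← hr]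
    change _ - S y / r * S x - S x / r * S y + _ = _
    field_simp
    ring
  have e1 : ∑ b ∈ T, ∑ x, d x * (g x b - S x / r) ^ 2 =
      ∑ b ∈ T, ∑ x, d x * g x b ^ 2 - (∑ x, d x * S x ^ 2) / r := by
    rw [Finset.sum_comm, Finset.sum_comm (s := T), Finset.sum_div, ← Finset.sum_sub_distrib]
    refine Finset.sum_congr rfl fun x _ => ?_
    have := e0 x x
    simp only [← sq] at this
    rw [← Finset.mul_sum, this, ← Finset.mul_sum]
    ring
  have e2 : ∑ b ∈ T, ∑ x, ∑ y, N x y * (g x b - S x / r) * (g y b - S y / r) =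
      ∑ b ∈ T, ∑ x, ∑ y, N x y * g x b * g y b - (∑ x, ∑ y, N x y * S x * S y) / r := by
    rw [Finset.sum_comm, Finset.sum_comm (s := T), Finset.sum_div Finset.univ, ← Finset.sum_sub_distrib]
    refine Finset.sum_congr rfl fun x _ => ?_
    rw [Finset.sum_comm, Finset.sum_comm (s := T), Finset.sum_div Finset.univ, ← Finset.sum_sub_distrib]
    refine Finset.sum_congr rfl fun y _ => ?_
    simp only [mul_assoc]
    rw [← Finset.mul_sum, e0, ← Finset.mul_sum]
    ring
  have e3 : ∑ b ∈ T, ∑ x, ∑ b' ∈ T.erase b, ∑ y, N x y * g x b * g y b' =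
      ∑ x, ∑ y, N x y * S x * S y - ∑ b ∈ T, ∑ x, ∑ y, N x y * g x b * g y b := by
    have h1 : ∑ x, ∑ y, N x y * S x * S y =
        ∑ b ∈ T, ∑ x, ∑ b' ∈ T, ∑ y, N x y * g x b * g y b' := by
      rw [Finset.sum_comm (s := T)]
      refine Finset.sum_congr rfl fun x _ => ?_
      rw [Finset.sum_congr rfl fun b _ => Finset.sum_comm, Finset.sum_comm (s := T)]
      refine Finset.sum_congr rfl fun y _ => ?_
      simp only [hS, Finset.mul_sum, Finset.sum_mul]
      exact Finset.sum_comm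
    rw [h1, ← Finset.sum_sub_distrib]
    refine Finset.sum_congr rfl fun b hb => ?_
    rw [← Finset.sum_sub_distrib]
    refine Finset.sum_congr rfl fun x _ => ?_
    rw [← Finset.sum_erase_add _ _ hb]
    ring
  have hE : 0 ≤ ∑ b ∈ T, ∑ x, d x * (g x b - S x / r) ^ 2 :=
    Finset.sum_nonneg fun b _ => Finset.sum_nonneg fun x _ => mul_nonneg (hd x) (sq_nonneg _)
  have hβE := mul_le_mul_of_nonneg_right hβ hE
  rw [e1] at hB hβE
  rw [e2] at hB
  rw [e3]
  set NS := ∑ x, ∑ y, N x y * S x * S y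
  set DS := ∑ x, d x * S x ^ 2
  set DG := ∑ b ∈ T, ∑ x, d x * g x b ^ 2
  have h4 : (1 - 1 / r) * NS ≤ (1 - 1 / r) * ((1 - ν) * DS) :=
    mul_le_mul_of_nonneg_left hA (by
      have : 1 / r ≤ 1 := by rw [div_le_one (by linarith)]; exact hr1
      linarith)
  have h5 : (1 - ν) * ((r - 1) * DG) =
      (1 - 1 / r) * ((1 - ν) * DS) + (1 - ν) * (r - 1) * (DG - DS / r) := by
    field_simp
    ring
  have h6 : (1 - 1 / r) * NS = NS - NS / r := by ring
  linarith

theorem not_injOn_snd_insert {V C : Type*} [DecidableEq V] [DecidableEq C]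
    {σ : Finset (V × C)} {x : V × C} (hx : x ∉ σ) (h : x.2 ∈ σ.image Prod.snd) :
    ¬ Set.InjOn Prod.snd (↑(insert x σ) : Set (V × C)) := by
  intro hinj
  obtain ⟨y, hy, hyx⟩ := Finset.mem_image.mp h
  have := hinj (by simp [hy]) (by simp) hyx
  exact hx (this ▸ hy)

theorem notMem_of_snd_notMem {V C : Type*} [DecidableEq C]
    {σ : Finset (V × C)} {x : V × C} (h : x.2 ∉ σ.image Prod.snd) : x ∉ σ :=
  fun hx => h (Finset.mem_image_of_mem _ hx)

/-- A sum over the extensions of a set by one element, for a weight that lives on the sets whose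
colours (second coordinates) are distinct. -/
theorem sum_insert_eq_sum_colors {V C : Type*} [Fintype V] [DecidableEq V] [Fintype C]
    [DecidableEq C] {M : Finset (V × C) → ℝ}
    (hM : ∀ σ : Finset (V × C), ¬ Set.InjOn Prod.snd (σ : Set (V × C)) → M σ = 0)
    (σ : Finset (V × C)) (g : V × C → ℝ) :
    ∑ x ∈ σᶜ, M (insert x σ) * g x =
      ∑ b ∈ (σ.image Prod.snd)ᶜ, ∑ v, M (insert (v, b) σ) * g (v, b) := by
  rw [Finset.sum_comm, ← Finset.sum_product']
  symm
  refine Finset.sum_subset (fun x hx => ?_) (fun x hx hx' => ?_)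
  · rw [Finset.mem_product, Finset.mem_compl] at hx
    exact Finset.mem_compl.mpr (notMem_of_snd_notMem hx.2)
  · rw [hM, zero_mul]
    refine not_injOn_snd_insert (Finset.mem_compl.mp hx) ?_
    by_contra h
    exact hx' (by simpa using h)

/-- The link of `ρ` is a tensor product when the weights of its edges depend only on the first
coordinates. -/
theorem hasLinkGap_of_product {V C : Type*} [Fintype V] [DecidableEq V] [Fintype C]
    [DecidableEq C] {M : Finset (V × C) → ℝ} (hM0 : ∀ σ, 0 ≤ M σ)
    (hM : ∀ σ : Finset (V × C), ¬ Set.InjOn Prod.snd (σ : Set (V × C)) → M σ = 0)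
    {ρ : Finset (V × C)} (hρ : Set.InjOn Prod.snd (ρ : Set (V × C)))
    (hcard : ρ.card + 2 ≤ Fintype.card C)
    (hbal : ∀ y ∈ ρᶜ, M (insert y ρ) = ∑ x ∈ (insert y ρ)ᶜ, M (insert x (insert y ρ)))
    (N : V → V → ℝ)
    (hN : ∀ b ∉ ρ.image Prod.snd, ∀ b' ∉ ρ.image Prod.snd, b ≠ b' → ∀ v v',
      M (insert (v', b') (insert (v, b) ρ)) = N v v')
    (d : V → ℝ) (hd : ∀ x, d x = ∑ y, N x y) (ν β : ℝ)
    (hgap : ∀ h : V → ℝ, ∑ x, d x * h x = 0 →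
      ∑ x, ∑ y, N x y * h x * h y ≤ (1 - ν) * ∑ x, d x * h x ^ 2)
    (hlow : ∀ h : V → ℝ, -β * ∑ x, d x * h x ^ 2 ≤ ∑ x, ∑ y, N x y * h x * h y)
    (hβ : β ≤ (1 - ν) * ((Fintype.card C : ℝ) - ρ.card - 1)) :
    HasLinkGap M ρ ν := by
  set T := (ρ.image Prod.snd)ᶜ with hT
  have hTc : T.card = Fintype.card C - ρ.card := by
    rw [hT, Finset.card_compl, Finset.card_image_of_injOn hρ]
  have hTr : (T.card : ℝ) = (Fintype.card C : ℝ) - ρ.card := by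
    rw [hTc, Nat.cast_sub (by omega)]
  have hTne : T.Nontrivial := by
    rw [← Finset.one_lt_card_iff_nontrivial, hTc]; omega
  have hTi : ∀ v b, (((insert (v, b) ρ).image Prod.snd)ᶜ : Finset C) = T.erase b := by
    intro v b
    rw [Finset.image_insert, Finset.compl_insert]
  have hN' : ∀ b ∈ T, ∀ b' ∈ T.erase b, ∀ v v',
      M (insert (v', b') (insert (v, b) ρ)) = N v v' := by
    intro b hb b' hb'
    have h1 := Finset.mem_of_mem_erase hb'
    rw [hT, Finset.mem_compl] at hb h1
    exact hN b hb b' h1 (Finset.ne_of_mem_erase hb').symm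
  have hdeg : ∀ b ∈ T, ∀ v, M (insert (v, b) ρ) = ((T.card : ℝ) - 1) * d v := by
    intro b hb v
    have hnot : (v, b) ∉ ρ := notMem_of_snd_notMem (Finset.mem_compl.mp hb)
    have h1 := sum_insert_eq_sum_colors hM (insert (v, b) ρ) fun _ => 1
    simp only [mul_one] at h1
    rw [hbal _ (Finset.mem_compl.mpr hnot), h1, hTi,
      Finset.sum_congr rfl fun b' hb' => Finset.sum_congr rfl fun v' _ => hN' b hb b' hb' v v',
      ← hd, Finset.sum_const, nsmul_eq_mul, Finset.card_erase_of_mem hb,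
      Nat.cast_sub (Finset.card_pos.mpr ⟨b, hb⟩), Nat.cast_one]
  have hr : (0 : ℝ) < (T.card : ℝ) - 1 := by
    rw [hTr, sub_sub, sub_pos]
    exact_mod_cast (by omega : ρ.card + 1 < Fintype.card C)
  have hd0 : ∀ v, 0 ≤ d v := by
    intro v
    obtain ⟨b, hb⟩ := hTne.nonempty
    have := hM0 (insert (v, b) ρ)
    rw [hdeg b hb] at this
    exact nonneg_of_mul_nonneg_right this hr
  have hsum1 : ∀ G : V × C → ℝ, ∑ y ∈ ρᶜ, M (insert y ρ) * G y =
      ((T.card : ℝ) - 1) * ∑ b ∈ T, ∑ v, d v * G (v, b) := by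
    intro G
    rw [sum_insert_eq_sum_colors hM, Finset.mul_sum]
    refine Finset.sum_congr rfl fun b hb => ?_
    rw [Finset.mul_sum]
    exact Finset.sum_congr rfl fun v _ => by rw [hdeg b hb, mul_assoc]
  intro g hg
  rw [hsum1] at hg
  have hg' := (mul_eq_zero.mp hg).resolve_left hr.ne'
  have key := tensor_complete_form_le N d hd0 T hTne.nonempty ν β hgap hlow
    (by rw [hTr]; exact hβ) (fun v b => g (v, b)) hg'
  rw [hsum1 fun y => g y ^ 2]
  refine le_of_eq_of_le ?_ key
  -- the inner sum carries the factor `g y`, which makes it a sum over extensions of `ρ`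
  have hinner : ∀ y, ∑ x ∈ (insert y ρ)ᶜ, M (insert x (insert y ρ)) * g y * g x =
      ∑ b ∈ ((insert y ρ).image Prod.snd)ᶜ, ∑ v,
        M (insert (v, b) (insert y ρ)) * (g y * g (v, b)) := by
    intro y
    rw [← sum_insert_eq_sum_colors hM (insert y ρ) fun x => g y * g x]
    exact Finset.sum_congr rfl fun x _ => by ring
  have hz : ∀ y ∈ ρᶜ, y.2 ∉ T →
      ∑ x ∈ (insert y ρ)ᶜ, M (insert x (insert y ρ)) * g y * g x = 0 := by
    intro y hy hyT
    have h0 : M (insert y ρ) = 0 := hM _ (not_injOn_snd_insert (Finset.mem_compl.mp hy)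
      (by simpa [hT] using hyT))
    rw [hbal y hy, Finset.sum_eq_zero_iff_of_nonneg fun x _ => hM0 _] at h0
    exact Finset.sum_eq_zero fun x hx => by rw [h0 x hx]; ring
  have hsub : (Finset.univ ×ˢ T : Finset (V × C)) ⊆ ρᶜ := fun x hx => by
    rw [Finset.mem_product, hT, Finset.mem_compl] at hx
    exact Finset.mem_compl.mpr (notMem_of_snd_notMem hx.2)
  rw [← Finset.sum_subset hsub fun y hy hy' => hz y hy (by simpa using hy'),
    Finset.sum_product, Finset.sum_comm]
  refine Finset.sum_congr rfl fun b hb => Finset.sum_congr rfl fun v _ => ?_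
  rw [hinner, hTi]
  refine Finset.sum_congr rfl fun b' hb' => Finset.sum_congr rfl fun v' _ => ?_
  rw [hN' b hb b' hb']
  ring

/-- A link of weight zero satisfies any Poincaré inequality. -/
theorem hasLinkGap_of_weight_eq_zero {α : Type*} [Fintype α] [DecidableEq α] {m : Finset α → ℝ}
    (hm : ∀ σ, 0 ≤ m σ) {ρ : Finset α} (hρ : m ρ = 0)
    (hbal₀ : m ρ = ∑ x ∈ ρᶜ, m (insert x ρ))
    (hbal : ∀ y ∈ ρᶜ, m (insert y ρ) = ∑ x ∈ (insert y ρ)ᶜ, m (insert x (insert y ρ)))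
    (ν : ℝ) : HasLinkGap m ρ ν := by
  rw [hρ, eq_comm, Finset.sum_eq_zero_iff_of_nonneg fun x _ => hm _] at hbal₀
  intro g _
  rw [Finset.sum_eq_zero fun y hy => ?_, Finset.sum_eq_zero fun y hy => ?_, mul_zero]
  · rw [hbal₀ y hy, zero_mul]
  · have h := hbal y hy
    rw [hbal₀ y hy, eq_comm, Finset.sum_eq_zero_iff_of_nonneg fun x _ => hm _] at h
    exact Finset.sum_eq_zero fun x hx => by rw [h x hx]; ring

/-! ### Gaps of the three kinds of weighted graphs that underlie the links -/

/-- The form of a weighted graph with a multiple of the degrees added as loops. -/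
theorem sum_lazy_form {V : Type*} [Fintype V] [DecidableEq V] (W : V → V → ℝ) (δ : V → ℝ)
    (l k : ℝ) (h : V → ℝ) :
    ∑ x, ∑ y, ((if x = y then l * δ x else 0) + k * W x y) * h x * h y =
      l * ∑ x, δ x * h x ^ 2 + k * ∑ x, ∑ y, W x y * h x * h y := by
  simp only [add_mul, Finset.sum_add_distrib, ite_mul, zero_mul, Finset.sum_ite_eq,
    Finset.mem_univ, if_true, Finset.mul_sum]
  congr 1
  · exact Finset.sum_congr rfl fun x _ => by ring
  · exact Finset.sum_congr rfl fun x _ => Finset.sum_congr rfl fun y _ => by ring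

theorem lazy_form_le {V : Type*} [Fintype V] [DecidableEq V] (W : V → V → ℝ) (δ : V → ℝ)
    {l k ν : ℝ} (hk : 0 ≤ k) (hlk : 0 < l + k)
    (hW : ∀ h : V → ℝ, ∑ x, δ x * h x = 0 →
      ∑ x, ∑ y, W x y * h x * h y ≤ (1 - ν) * ∑ x, δ x * h x ^ 2)
    (h : V → ℝ) (hh : ∑ x, (l + k) * δ x * h x = 0) :
    ∑ x, ∑ y, ((if x = y then l * δ x else 0) + k * W x y) * h x * h y ≤
      (1 - k / (l + k) * ν) * ∑ x, (l + k) * δ x * h x ^ 2 := by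
  simp only [mul_assoc (l + k), ← Finset.mul_sum] at hh ⊢
  have h1 := hW h ((mul_eq_zero.mp hh).resolve_left hlk.ne')
  rw [sum_lazy_form]
  have e : (1 - k / (l + k) * ν) * ((l + k) * ∑ x, δ x * h x ^ 2) =
      l * ∑ x, δ x * h x ^ 2 + k * ((1 - ν) * ∑ x, δ x * h x ^ 2) := by
    field_simp
    ring
  rw [e]
  linarith [mul_le_mul_of_nonneg_left h1 hk]

theorem le_lazy_form {V : Type*} [Fintype V] [DecidableEq V] (W : V → V → ℝ) (δ : V → ℝ)
    {l k : ℝ} (hk : 0 ≤ k) (hlk : 0 < l + k)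
    (hW : ∀ h : V → ℝ, -∑ x, δ x * h x ^ 2 ≤ ∑ x, ∑ y, W x y * h x * h y) (h : V → ℝ) :
    -((k - l) / (l + k)) * ∑ x, (l + k) * δ x * h x ^ 2 ≤
      ∑ x, ∑ y, ((if x = y then l * δ x else 0) + k * W x y) * h x * h y := by
  simp only [mul_assoc (l + k), ← Finset.mul_sum]
  rw [sum_lazy_form]
  have e : -((k - l) / (l + k)) * ((l + k) * ∑ x, δ x * h x ^ 2) =
      l * ∑ x, δ x * h x ^ 2 + k * (-∑ x, δ x * h x ^ 2) := by
    field_simp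
    ring
  rw [e]
  linarith [mul_le_mul_of_nonneg_left (hW h) hk]

/-- The edge weights of a star with centre `u` and edge weights `c * b * W v`, with a loop of
weight `L` at the centre and loops of weight `b * W v` at the leaves. This description presumes
`W u = 0`. -/
def starWeight {V : Type*} [DecidableEq V] (W : V → ℝ) (u : V) (L b c : ℝ) (x y : V) : ℝ :=
  (if x = u then if y = u then L else 0 else 0) + (if x = u then c * b * W y else 0) +
    (if y = u then c * b * W x else 0) + if x = y then b * W x else 0

theorem sum_starWeight {V : Type*} [Fintype V] [DecidableEq V] (W : V → ℝ) (u : V) (L b c : ℝ)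
    (x : V) : ∑ y, starWeight W u L b c x y =
      (if x = u then L + c * b * ∑ v, W v else 0) + (c + 1) * b * W x := by
  simp only [starWeight, Finset.sum_add_distrib, Finset.sum_ite_eq, Finset.sum_ite_eq',
    Finset.mem_univ, if_true]
  split_ifs with h
  · simp only [Finset.sum_ite_eq', Finset.mem_univ, if_true, ← Finset.mul_sum]
    ring
  · simp only [Finset.sum_const_zero]
    ring

theorem sum_starWeight_form {V : Type*} [Fintype V] [DecidableEq V] (W : V → ℝ) (u : V)
    (L b c : ℝ) (h : V → ℝ) :
    ∑ x, ∑ y, starWeight W u L b c x y * h x * h y =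
      L * h u ^ 2 + 2 * (c * b) * h u * ∑ v, W v * h v + b * ∑ v, W v * h v ^ 2 := by
  have e : ∀ x, ∑ y, starWeight W u L b c x y * h x * h y =
      (if x = u then L * h u ^ 2 + c * b * h u * ∑ v, W v * h v else 0) +
        c * b * h u * (W x * h x) + b * (W x * h x ^ 2) := by
    intro x
    simp only [starWeight, add_mul, Finset.sum_add_distrib, ite_mul, zero_mul, Finset.sum_ite_eq,
      Finset.sum_ite_eq', Finset.mem_univ, if_true]
    split_ifs with hx
    · subst hx
      simp only [Finset.sum_ite_eq', Finset.mem_univ, if_true]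
      rw [show ∑ y, c * b * W y * h x * h y = c * b * h x * ∑ v, W v * h v by
        rw [Finset.mul_sum]; exact Finset.sum_congr rfl fun y _ => by ring]
      ring
    · simp only [Finset.sum_const_zero]
      ring
  simp only [e, Finset.sum_add_distrib, Finset.sum_ite_eq', Finset.mem_univ, if_true,
    ← Finset.mul_sum]
  ring

theorem sum_star_degrees {V : Type*} [Fintype V] [DecidableEq V] (W : V → ℝ) (u : V)
    (A B : ℝ) (h : V → ℝ) :
    ∑ x, ((if x = u then A else 0) + B * W x) * h x = A * h u + B * ∑ v, W v * h v := by
  simp only [add_mul, Finset.sum_add_distrib, ite_mul, zero_mul, Finset.sum_ite_eq',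
    Finset.mem_univ, if_true, mul_assoc, ← Finset.mul_sum]

/-- All eigenvalues of the star but the top one are at most `1 / (c + 1)`. -/
theorem starWeight_form_le {V : Type*} [Fintype V] [DecidableEq V] {W : V → ℝ}
    (hW : ∀ v, 0 ≤ W v) (u : V) {L b c : ℝ} (hL : 0 ≤ L) (hb : 0 ≤ b) (hc : 0 < c) (h : V → ℝ)
    (hh : ∑ x, (∑ y, starWeight W u L b c x y) * h x = 0) :
    ∑ x, ∑ y, starWeight W u L b c x y * h x * h y ≤
      (1 - c / (c + 1)) * ∑ x, (∑ y, starWeight W u L b c x y) * h x ^ 2 := by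
  simp only [sum_starWeight] at hh ⊢
  rw [sum_star_degrees] at hh
  rw [sum_star_degrees W u _ _ fun x => h x ^ 2, sum_starWeight_form]
  set D := ∑ v, W v
  set X := ∑ v, W v * h v
  set Y := ∑ v, W v * h v ^ 2
  have hD : 0 ≤ D := Finset.sum_nonneg fun v _ => hW v
  have hX : (c + 1) * b * X = -((L + c * b * D) * h u) := by linarith
  have e : (1 - c / (c + 1)) * ((L + c * b * D) * h u ^ 2 + (c + 1) * b * Y) -
      (L * h u ^ 2 + 2 * (c * b) * h u * X + b * Y) =
      (1 / (c + 1)) * ((c * L + (c + 2 * c ^ 2) * b * D) * h u ^ 2) := by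
    have : 2 * (c * b) * h u * X = 2 * c * h u / (c + 1) * ((c + 1) * b * X) := by field_simp
    rw [this, hX]
    field_simp
    ring
  have : 0 ≤ (1 / (c + 1)) * ((c * L + (c + 2 * c ^ 2) * b * D) * h u ^ 2) := by positivity
  linarith

/-- All eigenvalues of the star are at least `-c / (c + 1)`. -/
theorem le_starWeight_form {V : Type*} [Fintype V] [DecidableEq V] {W : V → ℝ}
    (hW : ∀ v, 0 ≤ W v) (u : V) {L b c : ℝ} (hL : 0 ≤ L) (hb : 0 ≤ b) (hc : 0 < c) (h : V → ℝ) :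
    -(c / (c + 1)) * ∑ x, (∑ y, starWeight W u L b c x y) * h x ^ 2 ≤
      ∑ x, ∑ y, starWeight W u L b c x y * h x * h y := by
  simp only [sum_starWeight]
  rw [sum_star_degrees W u _ _ fun x => h x ^ 2, sum_starWeight_form]
  have hsq : 0 ≤ ∑ v, W v * (c * h u + (c + 1) * h v) ^ 2 :=
    Finset.sum_nonneg fun v _ => mul_nonneg (hW v) (sq_nonneg _)
  have e : ∀ v, W v * (c * h u + (c + 1) * h v) ^ 2 = c ^ 2 * h u ^ 2 * W v +
      2 * c * (c + 1) * h u * (W v * h v) + (c + 1) ^ 2 * (W v * h v ^ 2) := fun v => by ring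
  simp only [e, Finset.sum_add_distrib, ← Finset.mul_sum] at hsq
  set D := ∑ v, W v
  set X := ∑ v, W v * h v
  set Y := ∑ v, W v * h v ^ 2
  have e : L * h u ^ 2 + 2 * (c * b) * h u * X + b * Y -
      -(c / (c + 1)) * ((L + c * b * D) * h u ^ 2 + (c + 1) * b * Y) =
      (L + c / (c + 1) * L) * h u ^ 2 + b / (c + 1) *
        (c ^ 2 * h u ^ 2 * D + 2 * c * (c + 1) * h u * X + (c + 1) ^ 2 * Y) := by
    field_simp
    ring
  have : 0 ≤ (L + c / (c + 1) * L) * h u ^ 2 + b / (c + 1) *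
      (c ^ 2 * h u ^ 2 * D + 2 * c * (c + 1) * h u * X + (c + 1) ^ 2 * Y) := by positivity
  linarith

/-- The edge weights in the link of a face with `a v` elements over each vertex `v`. Up to a
factor, these are the two-step probabilities of a Pólya urn. -/
def urnWeight {V : Type*} [DecidableEq V] (K : ℝ) (a : V → ℝ) (x y : V) : ℝ :=
  K * a x * a y + if x = y then K * a x else 0

theorem sum_urnWeight {V : Type*} [Fintype V] [DecidableEq V] (K : ℝ) (a : V → ℝ) (x : V) :
    ∑ y, urnWeight K a x y = (∑ v, a v + 1) * K * a x := by
  simp only [urnWeight, Finset.sum_add_distrib, ← Finset.mul_sum, Finset.sum_ite_eq,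
    Finset.mem_univ, if_true]
  ring

theorem sum_urnWeight_form {V : Type*} [Fintype V] [DecidableEq V] (K : ℝ) (a : V → ℝ)
    (h : V → ℝ) : ∑ x, ∑ y, urnWeight K a x y * h x * h y =
      K * (∑ v, a v * h v) ^ 2 + K * ∑ v, a v * h v ^ 2 := by
  have e : ∀ x, ∑ y, urnWeight K a x y * h x * h y =
      K * (∑ v, a v * h v) * (a x * h x) + K * (a x * h x ^ 2) := by
    intro x
    simp only [urnWeight, add_mul, Finset.sum_add_distrib, ite_mul, zero_mul, Finset.sum_ite_eq,
      Finset.mem_univ, if_true]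
    congr 1
    · rw [Finset.mul_sum, Finset.sum_mul]
      exact Finset.sum_congr rfl fun y _ => by ring
    · ring
  simp only [e, Finset.sum_add_distrib, ← Finset.mul_sum]
  ring

theorem urnWeight_form_le {V : Type*} [Fintype V] [DecidableEq V] {K : ℝ} {a : V → ℝ}
    (ha : 0 < ∑ v, a v) (hK : 0 < K) (h : V → ℝ)
    (hh : ∑ x, (∑ y, urnWeight K a x y) * h x = 0) :
    ∑ x, ∑ y, urnWeight K a x y * h x * h y ≤
      (1 - (∑ v, a v) / (∑ v, a v + 1)) * ∑ x, (∑ y, urnWeight K a x y) * h x ^ 2 := by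
  simp only [sum_urnWeight, mul_assoc ((∑ v, a v + 1) * K), ← Finset.mul_sum] at hh ⊢
  rw [sum_urnWeight_form, (mul_eq_zero.mp hh).resolve_left (by positivity)]
  refine le_of_eq ?_
  field_simp
  ring

theorem urnWeight_form_nonneg {V : Type*} [Fintype V] [DecidableEq V] {K : ℝ} {a : V → ℝ}
    (ha : ∀ v, 0 ≤ a v) (hK : 0 ≤ K) (h : V → ℝ) :
    0 ≤ ∑ x, ∑ y, urnWeight K a x y * h x * h y := by
  rw [sum_urnWeight_form]
  have : 0 ≤ ∑ v, a v * h v ^ 2 := Finset.sum_nonneg fun v _ => mul_nonneg (ha v) (sq_nonneg _)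
  positivity

/-! ### Balanced weights, extended by zero -/

namespace FinComplex

variable {α : Type*} [DecidableEq α]

/-- A weight function on the faces of `X`, extended by `0` to all finite sets. -/
noncomputable def extendWeight (X : FinComplex α) (m : Finset α → ℝ) (σ : Finset α) : ℝ :=
  if σ ∈ X.faces then m σ else 0

theorem sum_ssubset_facesOfCard_eq [Fintype α] (X : FinComplex α) (σ : Finset α)
    (F : Finset α → ℝ) (hF : ∀ τ ∉ X.faces, F τ = 0) :
    ∑ τ ∈ X.facesOfCard (σ.card + 1) with σ ⊂ τ, F τ = ∑ x ∈ σᶜ, F (insert x σ) := by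
  have hinj : Set.InjOn (fun x => insert x σ) (↑(σᶜ) : Set α) := by
    intro x hx y hy hxy
    have hx' : x ∉ σ := by simpa using hx
    have : x ∈ insert y σ := by
      rw [← show insert x σ = insert y σ from hxy]
      exact Finset.mem_insert_self x σ
    exact (Finset.mem_insert.mp this).resolve_right hx'
  rw [← Finset.sum_image (f := F) hinj]
  refine Finset.sum_subset (fun τ hτ => ?_) (fun τ hτ hτ' => ?_)
  · simp only [facesOfCard, Finset.mem_filter] at hτ
    obtain ⟨x, hx⟩ := Finset.exists_of_ssubset hτ.2
    refine Finset.mem_image.mpr ⟨x, Finset.mem_compl.mpr hx.2, ?_⟩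
    refine Finset.eq_of_subset_of_card_le (Finset.insert_subset hx.1 hτ.2.subset) ?_
    rw [Finset.card_insert_of_notMem hx.2, hτ.1.2]
  · obtain ⟨x, hx, rfl⟩ := Finset.mem_image.mp hτ
    rw [Finset.mem_compl] at hx
    refine hF _ fun hf => hτ' ?_
    simp only [facesOfCard, Finset.mem_filter]
    exact ⟨⟨hf, Finset.card_insert_of_notMem hx⟩, Finset.ssubset_insert hx⟩

theorem IsBalanced.extendWeight_eq_sum [Fintype α] {X : FinComplex α} {H : ℕ} {m : Finset α → ℝ}
    (h : X.IsBalanced H m) (σ : Finset α) (hσ : σ.card ≤ H) :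
    X.extendWeight m σ = ∑ x ∈ σᶜ, X.extendWeight m (insert x σ) := by
  by_cases hf : σ ∈ X.faces
  · rw [← X.sum_ssubset_facesOfCard_eq σ (X.extendWeight m) fun τ hτ => if_neg hτ, extendWeight,
      if_pos hf, h σ.card (by omega) σ (Finset.mem_filter.mpr ⟨hf, rfl⟩)]
    refine Finset.sum_congr rfl fun τ hτ => ?_
    rw [extendWeight, if_pos (Finset.mem_filter.mp (Finset.mem_filter.mp hτ).1).1]
  · rw [extendWeight, if_neg hf, Finset.sum_eq_zero]
    exact fun x _ => if_neg fun hx => hf (X.down_closed (Finset.subset_insert x σ) hx)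

/-- Propagating positive weights downwards gives positive weights on a pure complex. -/
theorem propagate_generatedBy_pos {F : Finset (Finset α)} {H : ℕ}
    (hF : ∀ τ ∈ F, τ.card = H + 1) {top : Finset α → ℝ} (htop : ∀ τ ∈ F, 0 < top τ)
    {σ : Finset α} (hσ : σ ∈ (generatedBy F).faces) :
    0 < (generatedBy F).propagate H top σ := by
  have hcard : ∀ σ ∈ (generatedBy F).faces, σ.card ≤ H + 1 := by
    intro σ hσ
    simp only [generatedBy, Finset.mem_biUnion, Finset.mem_powerset] at hσ
    obtain ⟨τ, hτ, hστ⟩ := hσ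
    exact (Finset.card_le_card hστ).trans (hF τ hτ).le
  obtain ⟨n, hn⟩ := Nat.exists_eq_add_of_le (hcard σ hσ)
  induction n generalizing σ with
  | zero =>
    have hmem := hσ
    simp only [generatedBy, Finset.mem_biUnion, Finset.mem_powerset] at hσ
    obtain ⟨τ, hτ, hστ⟩ := hσ
    have : σ = τ := Finset.eq_of_subset_of_card_le hστ (by rw [hF τ hτ]; omega)
    rw [propagate_top _ _ _ (Finset.mem_filter.mpr ⟨hmem, by omega⟩), this]
    exact htop τ hτ
  | succ n ih =>
    have hmem := hσ
    rw [isBalanced_propagate (generatedBy F) H top σ.card (by omega) σ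
      (Finset.mem_filter.mpr ⟨hσ, rfl⟩)]
    refine Finset.sum_pos (fun τ hτ => ?_) ?_
    · simp only [facesOfCard, Finset.mem_filter] at hτ
      exact ih hτ.1.1 (by omega)
    · simp only [generatedBy, Finset.mem_biUnion, Finset.mem_powerset] at hσ
      obtain ⟨τ, hτ, hστ⟩ := hσ
      have hss : σ ⊂ τ := Finset.ssubset_iff_subset_ne.mpr ⟨hστ, by
        rintro rfl
        have := hF _ hτ
        omega⟩
      obtain ⟨x, hx, hxσ⟩ := Finset.exists_of_ssubset hss
      refine ⟨insert x σ, ?_⟩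
      simp only [facesOfCard, Finset.mem_filter, generatedBy, Finset.mem_biUnion,
        Finset.mem_powerset]
      exact ⟨⟨⟨τ, hτ, Finset.insert_subset hx hστ⟩, Finset.card_insert_of_notMem hxσ⟩,
        Finset.ssubset_insert hxσ⟩

end FinComplex

/-! ### The weights of the faces of `Z` -/

namespace SimpleGraph

variable {V : Type*}

/-- The weighted degree of a vertex. -/
noncomputable def weightedDegree [Fintype V] (G : SimpleGraph V) (w : Sym2 V → ℝ) (v : V) : ℝ :=
  ∑ u, G.weightedAdjMatrix w v u

theorem weightedAdjMatrix_of_adj {G : SimpleGraph V} (w : Sym2 V → ℝ) {u v : V}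
    (h : G.Adj u v) : G.weightedAdjMatrix w u v = w s(u, v) := by
  simp [weightedAdjMatrix, h]

theorem weightedAdjMatrix_of_not_adj {G : SimpleGraph V} (w : Sym2 V → ℝ) {u v : V}
    (h : ¬ G.Adj u v) : G.weightedAdjMatrix w u v = 0 := by
  simp [weightedAdjMatrix, h]

theorem weightedAdjMatrix_comm (G : SimpleGraph V) (w : Sym2 V → ℝ) (u v : V) :
    G.weightedAdjMatrix w u v = G.weightedAdjMatrix w v u := by
  by_cases h : G.Adj u v
  · rw [weightedAdjMatrix_of_adj w h, weightedAdjMatrix_of_adj w h.symm, Sym2.eq_swap]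
  · rw [weightedAdjMatrix_of_not_adj w h, weightedAdjMatrix_of_not_adj w fun h' => h h'.symm]

theorem weightedAdjMatrix_self (G : SimpleGraph V) (w : Sym2 V → ℝ) (u : V) :
    G.weightedAdjMatrix w u u = 0 := weightedAdjMatrix_of_not_adj w (G.loopless.irrefl u)

theorem weightedAdjMatrix_nonneg {G : SimpleGraph V} {w : Sym2 V → ℝ}
    (hw : ∀ e ∈ G.edgeSet, 0 < w e) (u v : V) : 0 ≤ G.weightedAdjMatrix w u v := by
  by_cases h : G.Adj u v
  · rw [weightedAdjMatrix_of_adj w h]; exact (hw _ h).le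
  · rw [weightedAdjMatrix_of_not_adj w h]

end SimpleGraph

namespace ZComplex

variable {V : Type*} [DecidableEq V]

theorem fiberCard_insert {s : ℕ} {σ : Finset (V × Fin s)} {x : V × Fin s} (hx : x ∉ σ) (u : V) :
    fiberCard (insert x σ) u = fiberCard σ u + if x.1 = u then 1 else 0 := by
  rw [fiberCard, Finset.filter_insert]
  split_ifs with h
  · rw [Finset.card_insert_of_notMem (by simp [hx]), fiberCard]
  · rfl

theorem exists_mem_of_fiberCard_pos {s : ℕ} {σ : Finset (V × Fin s)} {u : V}
    (h : 0 < fiberCard σ u) : ∃ x ∈ σ, x.1 = u := by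
  obtain ⟨x, hx⟩ := Finset.card_pos.mp h
  exact ⟨x, (Finset.mem_filter.mp hx).1, (Finset.mem_filter.mp hx).2⟩

theorem fiberCard_pos_of_mem {s : ℕ} {σ : Finset (V × Fin s)} {x : V × Fin s}
    (h : x ∈ σ) : 0 < fiberCard σ x.1 :=
  Finset.card_pos.mpr ⟨x, Finset.mem_filter.mpr ⟨h, rfl⟩⟩

theorem injOn_snd_insert {s : ℕ} {σ : Finset (V × Fin s)}
    (hσ : Set.InjOn Prod.snd (σ : Set (V × Fin s))) {v : V} {b : Fin s}
    (hb : b ∉ σ.image Prod.snd) :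
    Set.InjOn Prod.snd (↑(insert (v, b) σ) : Set (V × Fin s)) := by
  rw [Finset.coe_insert, Set.injOn_insert (by
    have := notMem_of_snd_notMem (x := (v, b)) hb
    exact_mod_cast this)]
  exact ⟨hσ, by simpa using hb⟩

theorem card_compl_colors {W : Type*} {s : ℕ} {σ : Finset (W × Fin s)}
    (hσ : Set.InjOn Prod.snd (σ : Set (W × Fin s))) :
    (((σ.image Prod.snd)ᶜ : Finset (Fin s)).card : ℝ) = (s : ℝ) - σ.card := by
  have hle : σ.card ≤ s := by
    rw [← Finset.card_image_of_injOn hσ]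
    exact (Finset.card_le_univ _).trans (by simp)
  rw [Finset.card_compl, Finset.card_image_of_injOn hσ, Fintype.card_fin, Nat.cast_sub hle]

variable [Fintype V]

/-- The factor of the weights of the faces with `c` elements that accounts for the choice of
colours in the larger faces, and for the normalisation of the weights of the top faces. -/
noncomputable def levelFactor (H s c : ℕ) : ℝ :=
  (∏ l ∈ Finset.Ico c (H + 1), ((s : ℝ) - l) * l) / ((H - 1).factorial : ℝ)

/-- The tail `1 / c + ⋯ + 1 / H` of the harmonic sum. -/
noncomputable def harmonicTail (H c : ℕ) : ℝ :=
  ∑ l ∈ Finset.Ico c (H + 1), 1 / (l : ℝ)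

theorem levelFactor_top (H s : ℕ) : levelFactor H s (H + 1) = 1 / ((H - 1).factorial : ℝ) := by
  simp [levelFactor]

theorem levelFactor_of_le {H s c : ℕ} (hc : c ≤ H) :
    levelFactor H s c = ((s : ℝ) - c) * c * levelFactor H s (c + 1) := by
  rw [levelFactor, Finset.prod_eq_prod_Ico_succ_bot (by omega), levelFactor, mul_div_assoc]

theorem levelFactor_pos {H s c : ℕ} (hs : H < s) (hc : 1 ≤ c) : 0 < levelFactor H s c := by
  refine div_pos (Finset.prod_pos fun l hl => ?_) (by positivity)
  rw [Finset.mem_Ico] at hl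
  have h1 : (l : ℝ) < s := by exact_mod_cast (by omega : l < s)
  have h2 : (0 : ℝ) < l := by exact_mod_cast (by omega : 0 < l)
  exact mul_pos (by linarith) h2

theorem harmonicTail_top (H : ℕ) : harmonicTail H (H + 1) = 0 := by
  simp [harmonicTail]

theorem harmonicTail_of_le {H c : ℕ} (hc : c ≤ H) :
    harmonicTail H c = 1 / (c : ℝ) + harmonicTail H (c + 1) := by
  rw [harmonicTail, Finset.sum_eq_sum_Ico_succ_bot (by omega), harmonicTail]

theorem harmonicTail_nonneg (H c : ℕ) : 0 ≤ harmonicTail H c :=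
  Finset.sum_nonneg fun _ _ => by positivity

/-- The weight function of `Z`, extended by zero to the sets that are not faces. -/
noncomputable def faceWeight (G : SimpleGraph V) (w : Sym2 V → ℝ) (H s : ℕ) :
    Finset (V × Fin s) → ℝ :=
  (complex G H s).extendWeight (weight G w H s)

theorem mem_topFaces {G : SimpleGraph V} {H s : ℕ} {σ : Finset (V × Fin s)} :
    σ ∈ topFaces G H s ↔ σ.card = H + 1 ∧ (∃ u v, G.Adj u v ∧ σ.image Prod.fst = {u, v}) ∧
      Set.InjOn Prod.snd (σ : Set (V × Fin s)) := by
  simp [topFaces]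

theorem mem_faces {G : SimpleGraph V} {H s : ℕ} {σ : Finset (V × Fin s)} :
    σ ∈ (complex G H s).faces ↔ ∃ τ ∈ topFaces G H s, σ ⊆ τ := by
  simp [complex, FinComplex.generatedBy]

theorem weight_pos {G : SimpleGraph V} {w : Sym2 V → ℝ} (hw : ∀ e ∈ G.edgeSet, 0 < w e)
    {H s : ℕ} {σ : Finset (V × Fin s)} (hσ : σ ∈ (complex G H s).faces) :
    0 < weight G w H s σ := by
  refine FinComplex.propagate_generatedBy_pos (fun τ hτ => (mem_topFaces.mp hτ).1)
    (fun τ hτ => ?_) hσ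
  obtain ⟨hc, ⟨u, v, huv, him⟩, -⟩ := mem_topFaces.mp hτ
  rw [topWeight_eq G w hc huv him]
  refine div_pos (hw _ huv) ?_
  have hv : 1 ≤ fiberCard τ v := by
    have : v ∈ τ.image Prod.fst := by simp [him]
    obtain ⟨p, hp, rfl⟩ := Finset.mem_image.mp this
    exact Finset.card_pos.mpr ⟨p, Finset.mem_filter.mpr ⟨hp, rfl⟩⟩
  have hsum : fiberCard τ u + fiberCard τ v = H + 1 := by
    have h1 := Finset.card_eq_sum_card_image Prod.fst τ
    rw [him, Finset.sum_pair huv.ne, hc] at h1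
    exact h1.symm
  exact_mod_cast Nat.choose_pos (by omega)

theorem faceWeight_nonneg {G : SimpleGraph V} {w : Sym2 V → ℝ} (hw : ∀ e ∈ G.edgeSet, 0 < w e)
    {H s : ℕ} (σ : Finset (V × Fin s)) : 0 ≤ faceWeight G w H s σ := by
  rw [faceWeight, FinComplex.extendWeight]
  split_ifs with h
  · exact (weight_pos hw h).le
  · exact le_rfl

theorem faceWeight_eq_sum (G : SimpleGraph V) (w : Sym2 V → ℝ) {H s : ℕ}
    (σ : Finset (V × Fin s)) (hσ : σ.card ≤ H) :
    faceWeight G w H s σ = ∑ x ∈ σᶜ, faceWeight G w H s (insert x σ) :=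
  (FinComplex.isBalanced_propagate _ H _).extendWeight_eq_sum σ hσ

theorem mem_faces_of_faceWeight_ne_zero {G : SimpleGraph V} {w : Sym2 V → ℝ} {H s : ℕ}
    {σ : Finset (V × Fin s)} (h : faceWeight G w H s σ ≠ 0) : σ ∈ (complex G H s).faces := by
  by_contra hf
  exact h (if_neg hf)

theorem faceWeight_of_not_injOn {G : SimpleGraph V} {w : Sym2 V → ℝ} {H s : ℕ}
    (σ : Finset (V × Fin s)) (h : ¬ Set.InjOn Prod.snd (σ : Set (V × Fin s))) :
    faceWeight G w H s σ = 0 := by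
  by_contra h0
  obtain ⟨τ, hτ, hστ⟩ := mem_faces.mp (mem_faces_of_faceWeight_ne_zero h0)
  exact h ((mem_topFaces.mp hτ).2.2.mono (by exact_mod_cast hστ))

theorem exists_adj_of_mem_faces {G : SimpleGraph V} {H s : ℕ}
    {σ : Finset (V × Fin s)} (h : σ ∈ (complex G H s).faces) :
    ∃ u v, G.Adj u v ∧ ∀ x ∈ σ, x.1 = u ∨ x.1 = v := by
  obtain ⟨τ, hτ, hστ⟩ := mem_faces.mp h
  obtain ⟨-, ⟨u, v, huv, him⟩, -⟩ := mem_topFaces.mp hτ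
  refine ⟨u, v, huv, fun x hx => ?_⟩
  have : x.1 ∈ τ.image Prod.fst := Finset.mem_image_of_mem _ (hστ hx)
  simpa [him] using this

/-- Distinct vertices under a set of nonzero weight are adjacent. -/
theorem faceWeight_of_not_adj {G : SimpleGraph V} {w : Sym2 V → ℝ} {H s : ℕ}
    {σ : Finset (V × Fin s)} {x y : V × Fin s} (hx : x ∈ σ) (hy : y ∈ σ) (hne : x.1 ≠ y.1)
    (hadj : ¬ G.Adj x.1 y.1) : faceWeight G w H s σ = 0 := by
  by_contra h0
  obtain ⟨u, v, huv, h⟩ := exists_adj_of_mem_faces (mem_faces_of_faceWeight_ne_zero h0)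
  have := huv.symm
  rcases h x hx with h1 | h1 <;> rcases h y hy with h2 | h2 <;> rw [h1, h2] at hadj hne <;>
    contradiction

theorem faceWeight_of_three {G : SimpleGraph V} {w : Sym2 V → ℝ} {H s : ℕ}
    {σ : Finset (V × Fin s)} {x y z : V × Fin s} (hx : x ∈ σ) (hy : y ∈ σ) (hz : z ∈ σ)
    (hxy : x.1 ≠ y.1) (hxz : x.1 ≠ z.1) (hyz : y.1 ≠ z.1) : faceWeight G w H s σ = 0 := by
  by_contra h0
  obtain ⟨u, v, -, h⟩ := exists_adj_of_mem_faces (mem_faces_of_faceWeight_ne_zero h0)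
  rcases h x hx with h1 | h1 <;> rcases h y hy with h2 | h2 <;> rcases h z hz with h3 | h3 <;>
    simp_all

theorem card_eq_sum_fiberCard {s : ℕ} (σ : Finset (V × Fin s)) :
    σ.card = ∑ v, fiberCard σ v :=
  Finset.card_eq_sum_card_fiberwise fun _ _ => Finset.mem_coe.mpr (Finset.mem_univ _)

/-- The weight of a set as the sum over the vertex and the colour of an additional element. -/
theorem faceWeight_eq_sum_colors (G : SimpleGraph V) (w : Sym2 V → ℝ) {H s : ℕ}
    (σ : Finset (V × Fin s)) (hσ : σ.card ≤ H) :
    faceWeight G w H s σ =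
      ∑ b ∈ (σ.image Prod.snd)ᶜ, ∑ v, faceWeight G w H s (insert (v, b) σ) := by
  have h := sum_insert_eq_sum_colors (M := faceWeight G w H s) faceWeight_of_not_injOn σ fun _ => 1
  simp only [mul_one] at h
  rw [faceWeight_eq_sum G w σ hσ, h]

/-- The weight of a face over an edge. The recursion is that of a Pólya urn. -/
theorem faceWeight_edge (G : SimpleGraph V) (w : Sym2 V → ℝ) {H s : ℕ} {u v : V}
    (huv : G.Adj u v) {i j : ℕ} (hij : i + j + 2 ≤ H + 1) {σ : Finset (V × Fin s)}
    (hinj : Set.InjOn Prod.snd (σ : Set (V × Fin s))) (hcard : σ.card = i + j + 2)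
    (hi : fiberCard σ u = i + 1) (hj : fiberCard σ v = j + 1) :
    faceWeight G w H s σ = G.weightedAdjMatrix w u v * levelFactor H s (i + j + 2) *
      ((i.factorial : ℝ) * (j.factorial : ℝ)) := by
  obtain ⟨n, hn⟩ := Nat.exists_eq_add_of_le hij
  obtain ⟨x, hx, hxu⟩ := exists_mem_of_fiberCard_pos (σ := σ) (u := u) (by omega)
  obtain ⟨y, hy, hyv⟩ := exists_mem_of_fiberCard_pos (σ := σ) (u := v) (by omega)
  have hne : u ≠ v := huv.ne
  rw [SimpleGraph.weightedAdjMatrix_of_adj w huv]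
  induction n generalizing i j σ with
  | zero =>
    have him : σ.image Prod.fst = {u, v} := by
      have hsum := card_eq_sum_fiberCard σ
      rw [← Finset.add_sum_erase _ _ (Finset.mem_univ u),
        ← Finset.add_sum_erase _ _ (Finset.mem_erase.mpr ⟨hne.symm, Finset.mem_univ v⟩), hcard,
        hi, hj] at hsum
      have hz : ∑ z ∈ (Finset.univ.erase u).erase v, fiberCard σ z = 0 := by omega
      ext z
      simp only [Finset.mem_image, Finset.mem_insert, Finset.mem_singleton]
      constructor
      · rintro ⟨p, hp, rfl⟩
        by_contra hz'
        push Not at hz'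
        have := Finset.sum_eq_zero_iff.mp hz p.1 (by simp [hz'.1, hz'.2])
        have := fiberCard_pos_of_mem hp
        omega
      · rintro (rfl | rfl)
        · exact ⟨x, hx, hxu⟩
        · exact ⟨y, hy, hyv⟩
    have hc : σ.card = H + 1 := by omega
    have htop : σ ∈ topFaces G H s := mem_topFaces.mpr ⟨hc, ⟨u, v, huv, him⟩, hinj⟩
    have hf : σ ∈ (complex G H s).faces := mem_faces.mpr ⟨σ, htop, subset_rfl⟩
    have hH : H - 1 = i + j := by omega
    rw [faceWeight, FinComplex.extendWeight, if_pos hf, weight,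
      FinComplex.propagate_top _ _ _ (Finset.mem_filter.mpr ⟨hf, hc⟩),
      topWeight_eq G w hc huv him, hi, Nat.add_sub_cancel, show i + j + 2 = H + 1 by omega,
      levelFactor_top, hH, Nat.cast_add_choose]
    field_simp
  | succ n ih =>
    have hstep : ∀ b ∈ (σ.image Prod.snd)ᶜ, ∑ z, faceWeight G w H s (insert (z, b) σ) =
        w s(u, v) * levelFactor H s (i + j + 2 + 1) *
          (((i + 1).factorial : ℝ) * (j.factorial : ℝ)) +
        w s(u, v) * levelFactor H s (i + j + 2 + 1) *
          ((i.factorial : ℝ) * ((j + 1).factorial : ℝ)) := by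
      intro b hb
      rw [Finset.mem_compl] at hb
      have hnot : ∀ z, (z, b) ∉ σ := fun z => notMem_of_snd_notMem hb
      rw [Fintype.sum_eq_add u v hne fun z hz => ?_]
      · rw [show i + j + 2 + 1 = (i + 1) + j + 2 by omega]
        congr 1
        · refine ih (by omega) (injOn_snd_insert hinj hb) ?_ ?_ ?_ (by omega)
            (Finset.mem_insert_of_mem hx) (Finset.mem_insert_of_mem hy)
          · rw [Finset.card_insert_of_notMem (hnot u)]; omega
          · rw [fiberCard_insert (hnot u), hi, if_pos rfl]
          · rw [fiberCard_insert (hnot u), hj, if_neg hne]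
        · rw [show (i + 1) + j + 2 = i + (j + 1) + 2 by omega]
          refine ih (by omega) (injOn_snd_insert hinj hb) ?_ ?_ ?_ (by omega)
            (Finset.mem_insert_of_mem hx) (Finset.mem_insert_of_mem hy)
          · rw [Finset.card_insert_of_notMem (hnot v)]; omega
          · rw [fiberCard_insert (hnot v), hi, if_neg hne.symm]
          · rw [fiberCard_insert (hnot v), hj, if_pos rfl]
      · exact faceWeight_of_three (x := x) (y := y) (z := (z, b)) (Finset.mem_insert_of_mem hx)
          (Finset.mem_insert_of_mem hy) (Finset.mem_insert_self _ _) (by rw [hxu, hyv]; exact hne)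
          (by rw [hxu]; exact hz.1.symm) (by rw [hyv]; exact hz.2.symm)
    rw [faceWeight_eq_sum_colors G w σ (by omega), Finset.sum_congr rfl hstep, Finset.sum_const,
      nsmul_eq_mul, card_compl_colors hinj, hcard, levelFactor_of_le (by omega : i + j + 2 ≤ H),
      Nat.factorial_succ, Nat.factorial_succ]
    push_cast
    ring

/-- The weight of a face over a single vertex. Its elements accumulate the contributions of all
edges at that vertex, which produces the harmonic sum. -/
theorem faceWeight_vertex (G : SimpleGraph V) (w : Sym2 V → ℝ) {H s : ℕ} {u : V}
    {c : ℕ} (hc : c ≤ H) {σ : Finset (V × Fin s)}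
    (hinj : Set.InjOn Prod.snd (σ : Set (V × Fin s))) (hcard : σ.card = c + 1)
    (hu : ∀ x ∈ σ, x.1 = u) :
    faceWeight G w H s σ = G.weightedDegree w u * (levelFactor H s (c + 1) *
      ((c.factorial : ℝ) * harmonicTail H (c + 1))) := by
  obtain ⟨n, hn⟩ := Nat.exists_eq_add_of_le hc
  obtain ⟨x, hx⟩ : σ.Nonempty := Finset.card_pos.mp (by omega)
  have hxu := hu x hx
  induction n generalizing c σ with
  | zero =>
    rw [show c + 1 = H + 1 by omega, harmonicTail_top, mul_zero, mul_zero, mul_zero]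
    by_contra h0
    obtain ⟨τ, hτ, hστ⟩ := mem_faces.mp (mem_faces_of_faceWeight_ne_zero h0)
    obtain ⟨hτc, ⟨a, b, hab, him⟩, -⟩ := mem_topFaces.mp hτ
    have : σ = τ := Finset.eq_of_subset_of_card_le hστ (by omega)
    subst this
    have h1 : ∀ z ∈ σ.image Prod.fst, z = u := by
      intro z hz
      obtain ⟨p, hp, rfl⟩ := Finset.mem_image.mp hz
      exact hu p hp
    exact hab.ne ((h1 a (by simp [him])).trans (h1 b (by simp [him])).symm)
  | succ n ih =>
    have hfib : fiberCard σ u = c + 1 := by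
      rw [fiberCard, Finset.filter_true_of_mem hu, hcard]
    have hstep : ∀ b ∈ (σ.image Prod.snd)ᶜ, ∑ z, faceWeight G w H s (insert (z, b) σ) =
        G.weightedDegree w u * (levelFactor H s (c + 1 + 1) *
          (((c + 1).factorial : ℝ) * harmonicTail H (c + 1 + 1))) +
        G.weightedDegree w u * (levelFactor H s (c + 1 + 1) * (c.factorial : ℝ)) := by
      intro b hb
      rw [Finset.mem_compl] at hb
      have hnot : ∀ z, (z, b) ∉ σ := fun z => notMem_of_snd_notMem hb
      have hval : ∀ z, faceWeight G w H s (insert (z, b) σ) =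
          (if z = u then G.weightedDegree w u * (levelFactor H s (c + 1 + 1) *
            (((c + 1).factorial : ℝ) * harmonicTail H (c + 1 + 1))) else 0) +
          G.weightedAdjMatrix w u z * (levelFactor H s (c + 1 + 1) * (c.factorial : ℝ)) := by
        intro z
        by_cases hz : z = u
        · subst hz
          rw [if_pos rfl, G.weightedAdjMatrix_self, zero_mul, add_zero]
          refine ih (by omega) (injOn_snd_insert hinj hb) ?_ ?_ (by omega)
            (Finset.mem_insert_of_mem hx)
          · rw [Finset.card_insert_of_notMem (hnot z), hcard]
          · intro p hp
            rcases Finset.mem_insert.mp hp with rfl | hp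
            · rfl
            · exact hu p hp
        · rw [if_neg hz, zero_add]
          by_cases hadj : G.Adj u z
          · rw [faceWeight_edge G w hadj (i := c) (j := 0) (by omega) (injOn_snd_insert hinj hb)
              (by rw [Finset.card_insert_of_notMem (hnot z), hcard])
              (by rw [fiberCard_insert (hnot z), hfib, if_neg hz])]
            · simp [mul_assoc]
            · rw [fiberCard_insert (hnot z), if_pos rfl, Nat.add_eq_right]
              by_contra h0
              obtain ⟨p, hp, hpz⟩ := exists_mem_of_fiberCard_pos (Nat.pos_of_ne_zero h0)
              exact hz (hpz.symm.trans (hu p hp))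
          · rw [G.weightedAdjMatrix_of_not_adj w hadj, zero_mul]
            exact faceWeight_of_not_adj (x := x) (y := (z, b)) (Finset.mem_insert_of_mem hx)
              (Finset.mem_insert_self _ _) (by rw [hxu]; exact fun h => hz h.symm)
              (by rw [hxu]; exact hadj)
      simp only [hval, Finset.sum_add_distrib, Finset.sum_ite_eq', Finset.mem_univ, if_true,
        ← Finset.sum_mul]
      rfl
    rw [faceWeight_eq_sum_colors G w σ (by omega), Finset.sum_congr rfl hstep, Finset.sum_const,
      nsmul_eq_mul, card_compl_colors hinj, hcard, levelFactor_of_le (by omega : c + 1 ≤ H),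
      harmonicTail_of_le (by omega : c + 1 ≤ H), Nat.factorial_succ]
    have : ((c : ℝ) + 1) ≠ 0 := by positivity
    push_cast
    field_simp
    ring

end ZComplex

/-! ### The links of the faces of `Z` -/

namespace ZComplex

variable {V : Type*} [Fintype V] [DecidableEq V]

/-- The link of the empty face is the product of `G`, made lazy, with a complete graph. -/
theorem faceWeight_pair (G : SimpleGraph V) (w : Sym2 V → ℝ) {H s : ℕ} (hH : 2 ≤ H)
    {b b' : Fin s} (hb : b ≠ b') (v v' : V) :
    faceWeight G w H s (insert (v', b') (insert (v, b) ∅)) =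
      (if v = v' then levelFactor H s 2 * harmonicTail H 2 * G.weightedDegree w v else 0) +
        levelFactor H s 2 * G.weightedAdjMatrix w v v' := by
  have hnot : (v', b') ∉ (insert (v, b) ∅ : Finset (V × Fin s)) := by
    simp [Prod.ext_iff, hb.symm]
  have hinj : Set.InjOn Prod.snd
      (↑(insert (v', b') (insert (v, b) ∅) : Finset (V × Fin s)) : Set (V × Fin s)) :=
    injOn_snd_insert (injOn_snd_insert (by simp) (by simp)) (by simpa using hb.symm)
  have hcard : (insert (v', b') (insert (v, b) ∅) : Finset (V × Fin s)).card = 2 := by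
    rw [Finset.card_insert_of_notMem hnot]; simp
  have hfib : ∀ u, fiberCard (insert (v', b') (insert (v, b) (∅ : Finset (V × Fin s)))) u =
      (if v = u then 1 else 0) + if v' = u then 1 else 0 := by
    intro u
    rw [fiberCard_insert hnot, fiberCard_insert (by simp)]
    simp [fiberCard]
  by_cases hv : v = v'
  · subst hv
    rw [faceWeight_vertex G w (c := 1) (by omega) hinj hcard (u := v) (by simp), if_pos rfl,
      G.weightedAdjMatrix_self]
    simp
    ring
  · rw [if_neg hv, zero_add]
    by_cases hadj : G.Adj v v'
    · rw [faceWeight_edge G w hadj (i := 0) (j := 0) (by omega) hinj hcard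
        (by rw [hfib, if_pos rfl, if_neg fun h => hv h.symm])
        (by rw [hfib, if_pos rfl, if_neg hv])]
      simp [mul_comm]
    · rw [G.weightedAdjMatrix_of_not_adj w hadj, mul_zero]
      exact faceWeight_of_not_adj (x := (v, b)) (y := (v', b')) (by simp) (by simp) hv hadj

/-- The link of a face over a vertex is the product of a star with a complete graph. -/
theorem faceWeight_insert_insert_vertex (G : SimpleGraph V) (w : Sym2 V → ℝ) {H s c : ℕ}
    (hc : c + 2 ≤ H) {u : V} {ρ : Finset (V × Fin s)}
    (hinj : Set.InjOn Prod.snd (ρ : Set (V × Fin s))) (hcard : ρ.card = c + 1)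
    (hu : ∀ x ∈ ρ, x.1 = u) {b b' : Fin s} (hb : b ∉ ρ.image Prod.snd)
    (hb' : b' ∉ ρ.image Prod.snd) (hne : b ≠ b') (v v' : V) :
    faceWeight G w H s (insert (v', b') (insert (v, b) ρ)) =
      starWeight (G.weightedAdjMatrix w u) u (G.weightedDegree w u * (levelFactor H s (c + 3) *
        (((c + 2).factorial : ℝ) * harmonicTail H (c + 3))))
        (levelFactor H s (c + 3) * (c.factorial : ℝ)) ((c : ℝ) + 1) v v' := by
  have hnot₁ : (v, b) ∉ ρ := notMem_of_snd_notMem hb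
  have hb'' : b' ∉ (insert (v, b) ρ).image Prod.snd := by
    rw [Finset.image_insert, Finset.mem_insert, not_or]
    exact ⟨hne.symm, hb'⟩
  have hnot₂ : (v', b') ∉ insert (v, b) ρ := notMem_of_snd_notMem hb''
  have hinj' := injOn_snd_insert (injOn_snd_insert hinj hb (v := v)) hb'' (v := v')
  have hcard' : (insert (v', b') (insert (v, b) ρ)).card = c + 3 := by
    rw [Finset.card_insert_of_notMem hnot₂, Finset.card_insert_of_notMem hnot₁, hcard]
  have hfibu : fiberCard ρ u = c + 1 := by
    rw [fiberCard, Finset.filter_true_of_mem hu, hcard]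
  have hfib0 : ∀ z, z ≠ u → fiberCard ρ z = 0 := by
    intro z hz
    by_contra h0
    obtain ⟨p, hp, hpz⟩ := exists_mem_of_fiberCard_pos (Nat.pos_of_ne_zero h0)
    exact hz (hpz.symm.trans (hu p hp))
  have hfib : ∀ z, fiberCard (insert (v', b') (insert (v, b) ρ)) z =
      fiberCard ρ z + (if v = z then 1 else 0) + if v' = z then 1 else 0 := by
    intro z
    rw [fiberCard_insert hnot₂, fiberCard_insert hnot₁]
  obtain ⟨x, hx⟩ : ρ.Nonempty := Finset.card_pos.mp (by omega)
  have hx' : x ∈ insert (v', b') (insert (v, b) ρ) :=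
    Finset.mem_insert_of_mem (Finset.mem_insert_of_mem hx)
  have hv' : (v', b') ∈ insert (v', b') (insert (v, b) ρ) := Finset.mem_insert_self _ _
  have hv : (v, b) ∈ insert (v', b') (insert (v, b) ρ) :=
    Finset.mem_insert_of_mem (Finset.mem_insert_self _ _)
  have hxu := hu x hx
  -- the weight when an edge at `u` is present
  have hedge : ∀ z, z ≠ u → ∀ i j : ℕ, i + j = c + 1 →
      fiberCard (insert (v', b') (insert (v, b) ρ)) u = i + 1 →
      fiberCard (insert (v', b') (insert (v, b) ρ)) z = j + 1 → (v = z ∨ v' = z) →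
      faceWeight G w H s (insert (v', b') (insert (v, b) ρ)) =
        G.weightedAdjMatrix w u z * levelFactor H s (c + 3) *
          ((i.factorial : ℝ) * (j.factorial : ℝ)) := by
    intro z hz i j hij hi hj hvz
    by_cases hadj : G.Adj u z
    · rw [faceWeight_edge G w hadj (i := i) (j := j) (by omega) hinj' (by omega) hi hj,
        show i + j + 2 = c + 3 by omega]
    · rw [G.weightedAdjMatrix_of_not_adj w hadj, zero_mul, zero_mul]
      rcases hvz with rfl | rfl
      · exact faceWeight_of_not_adj hx' hv (by rw [hxu]; exact hz.symm) (by rw [hxu]; exact hadj)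
      · exact faceWeight_of_not_adj hx' hv' (by rw [hxu]; exact hz.symm) (by rw [hxu]; exact hadj)
  have hself := G.weightedAdjMatrix_self w u
  rw [starWeight]
  by_cases h1 : v = u <;> by_cases h2 : v' = u
  · rw [faceWeight_vertex G w (c := c + 2) (by omega) hinj' hcard' (u := u) (by
      intro p hp
      simp only [Finset.mem_insert] at hp
      rcases hp with rfl | rfl | hp
      · exact h2
      · exact h1
      · exact hu p hp)]
    simp [h1, h2, hself]
  · rw [hedge v' h2 (c + 1) 0 (by omega)
      (by rw [hfib, hfibu, if_pos h1, if_neg h2])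
      (by rw [hfib, hfib0 _ h2, if_neg (by rw [h1]; exact fun h => h2 h.symm), if_pos rfl])
      (Or.inr rfl)]
    simp only [h1, h2, hself, Nat.factorial_succ, if_true, if_false, mul_zero, ite_self]
    push_cast
    simp
    ring
  · rw [hedge v h1 (c + 1) 0 (by omega)
      (by rw [hfib, hfibu, if_neg h1, if_pos h2])
      (by rw [hfib, hfib0 _ h1, if_pos rfl, if_neg (by rw [h2]; exact fun h => h1 h.symm)])
      (Or.inl rfl)]
    simp only [h1, h2, Nat.factorial_succ, if_true, if_false]
    push_cast
    simp
    ring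
  · simp only [if_neg h1, if_neg h2]
    by_cases h3 : v = v'
    · rw [hedge v h1 c 1 (by omega)
        (by rw [hfib, hfibu, if_neg h1, if_neg h2])
        (by rw [hfib, hfib0 _ h1, if_pos rfl, if_pos h3.symm])
        (Or.inl rfl), if_pos h3]
      simp
      ring
    · rw [if_neg h3, faceWeight_of_three hx' hv hv' (by rw [hxu]; exact fun h => h1 h.symm)
        (by rw [hxu]; exact fun h => h2 h.symm) h3]
      simp

/-- The link of a face over an edge is the product of a Pólya urn with a complete graph. -/
theorem faceWeight_insert_insert_edge (G : SimpleGraph V) (w : Sym2 V → ℝ) {H s i j : ℕ}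
    (hij : i + j + 3 ≤ H) {u v : V} (huv : G.Adj u v) {ρ : Finset (V × Fin s)}
    (hinj : Set.InjOn Prod.snd (ρ : Set (V × Fin s))) (hcard : ρ.card = i + j + 2)
    (hi : fiberCard ρ u = i + 1) (hj : fiberCard ρ v = j + 1)
    {b b' : Fin s} (hb : b ∉ ρ.image Prod.snd)
    (hb' : b' ∉ ρ.image Prod.snd) (hne : b ≠ b') (z z' : V) :
    faceWeight G w H s (insert (z', b') (insert (z, b) ρ)) =
      urnWeight (G.weightedAdjMatrix w u v * levelFactor H s (i + j + 4) *
        ((i.factorial : ℝ) * (j.factorial : ℝ))) (fun x => (fiberCard ρ x : ℝ)) z z' := by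
  have hnot₁ : (z, b) ∉ ρ := notMem_of_snd_notMem hb
  have hb'' : b' ∉ (insert (z, b) ρ).image Prod.snd := by
    rw [Finset.image_insert, Finset.mem_insert, not_or]
    exact ⟨hne.symm, hb'⟩
  have hnot₂ : (z', b') ∉ insert (z, b) ρ := notMem_of_snd_notMem hb''
  have hinj' := injOn_snd_insert (injOn_snd_insert hinj hb (v := z)) hb'' (v := z')
  have hcard' : (insert (z', b') (insert (z, b) ρ)).card = i + j + 4 := by
    rw [Finset.card_insert_of_notMem hnot₂, Finset.card_insert_of_notMem hnot₁, hcard]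
  have hfib : ∀ x, fiberCard (insert (z', b') (insert (z, b) ρ)) x =
      fiberCard ρ x + (if z = x then 1 else 0) + if z' = x then 1 else 0 := by
    intro x
    rw [fiberCard_insert hnot₂, fiberCard_insert hnot₁]
  obtain ⟨x, hx, hxu⟩ := exists_mem_of_fiberCard_pos (σ := ρ) (u := u) (by omega)
  obtain ⟨y, hy, hyv⟩ := exists_mem_of_fiberCard_pos (σ := ρ) (u := v) (by omega)
  have huv' := huv.ne
  have hfib0 : ∀ a, a ≠ u → a ≠ v → fiberCard ρ a = 0 := by
    intro a hau hav
    have hsum := card_eq_sum_fiberCard ρ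
    rw [← Finset.add_sum_erase _ _ (Finset.mem_univ u),
      ← Finset.add_sum_erase _ _ (Finset.mem_erase.mpr ⟨huv'.symm, Finset.mem_univ v⟩), hcard,
      hi, hj] at hsum
    have hz : ∑ z ∈ (Finset.univ.erase u).erase v, fiberCard ρ z = 0 := by omega
    exact Finset.sum_eq_zero_iff.mp hz a (by simp [hau, hav])
  have hx' : x ∈ insert (z', b') (insert (z, b) ρ) :=
    Finset.mem_insert_of_mem (Finset.mem_insert_of_mem hx)
  have hy' : y ∈ insert (z', b') (insert (z, b) ρ) :=
    Finset.mem_insert_of_mem (Finset.mem_insert_of_mem hy)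
  have hz' : (z', b') ∈ insert (z', b') (insert (z, b) ρ) := Finset.mem_insert_self _ _
  have hz : (z, b) ∈ insert (z', b') (insert (z, b) ρ) :=
    Finset.mem_insert_of_mem (Finset.mem_insert_self _ _)
  have hxy : x.1 ≠ y.1 := by rw [hxu, hyv]; exact huv'
  rw [urnWeight]
  by_cases h1 : z ≠ u ∧ z ≠ v
  · rw [faceWeight_of_three hx' hy' hz hxy (by rw [hxu]; exact h1.1.symm)
      (by rw [hyv]; exact h1.2.symm), hfib0 z h1.1 h1.2]
    simp
  by_cases h2 : z' ≠ u ∧ z' ≠ v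
  · rw [faceWeight_of_three hx' hy' hz' hxy (by rw [hxu]; exact h2.1.symm)
      (by rw [hyv]; exact h2.2.symm), hfib0 z' h2.1 h2.2, if_neg]
    · simp
    · rintro rfl
      exact h1 h2
  have h1' : z = u ∨ z = v := by tauto
  have h2' : z' = u ∨ z' = v := by tauto
  have hedge : ∀ i' j' : ℕ, i' + j' = i + j + 2 →
      fiberCard (insert (z', b') (insert (z, b) ρ)) u = i' + 1 →
      fiberCard (insert (z', b') (insert (z, b) ρ)) v = j' + 1 →
      faceWeight G w H s (insert (z', b') (insert (z, b) ρ)) =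
        G.weightedAdjMatrix w u v * levelFactor H s (i + j + 4) *
          ((i'.factorial : ℝ) * (j'.factorial : ℝ)) := by
    intro i' j' hij' hi' hj'
    rw [faceWeight_edge G w huv (i := i') (j := j') (by omega) hinj' (by omega) hi' hj',
      show i' + j' + 2 = i + j + 4 by omega]
  rcases h1' with rfl | rfl <;> rcases h2' with rfl | rfl
  · rw [hedge (i + 2) j (by omega) (by rw [hfib, hi]; simp)
      (by rw [hfib, hj]; simp [huv']), hi, if_pos rfl]
    simp only [Nat.factorial_succ]
    push_cast
    ring
  · rw [hedge (i + 1) (j + 1) (by omega) (by rw [hfib, hi]; simp [huv'.symm])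
      (by rw [hfib, hj]; simp [huv']), hi, hj, if_neg huv']
    simp only [Nat.factorial_succ]
    push_cast
    ring
  · rw [hedge (i + 1) (j + 1) (by omega) (by rw [hfib, hi]; simp [huv'.symm])
      (by rw [hfib, hj]; simp [huv']), hi, hj, if_neg huv'.symm]
    simp only [Nat.factorial_succ]
    push_cast
    ring
  · rw [hedge i (j + 2) (by omega) (by rw [hfib, hi]; simp [huv'.symm])
      (by rw [hfib, hj]; simp), hj, if_pos rfl]
    simp only [Nat.factorial_succ]
    push_cast
    ring

/-- The links of the nonempty faces with `c` elements have the gap `c / (c + 1)`, which does not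
depend on `G`. -/
theorem hasLinkGap_of_nonempty {G : SimpleGraph V} {w : Sym2 V → ℝ}
    (hw : ∀ e ∈ G.edgeSet, 0 < w e) {H s : ℕ} (hs : 2 * H ≤ s)
    {ρ : Finset (V × Fin s)} (hρ : 1 ≤ ρ.card) (hρH : ρ.card + 1 ≤ H) :
    HasLinkGap (faceWeight G w H s) ρ ((ρ.card : ℝ) / ((ρ.card : ℝ) + 1)) := by
  have hbal : ∀ y ∈ ρᶜ, faceWeight G w H s (insert y ρ) =
      ∑ x ∈ (insert y ρ)ᶜ, faceWeight G w H s (insert x (insert y ρ)) := fun y hy =>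
    faceWeight_eq_sum G w _ (by
      rw [Finset.card_insert_of_notMem (Finset.mem_compl.mp hy)]; omega)
  by_cases h0 : faceWeight G w H s ρ = 0
  · exact hasLinkGap_of_weight_eq_zero (faceWeight_nonneg hw) h0
      (faceWeight_eq_sum G w ρ (by omega)) hbal _
  have hinj : Set.InjOn Prod.snd (ρ : Set (V × Fin s)) := by
    by_contra h
    exact h0 (faceWeight_of_not_injOn ρ h)
  have hcardle : ρ.card + 2 ≤ Fintype.card (Fin s) := by rw [Fintype.card_fin]; omega
  have hgapnonneg : (1 : ℝ) - (ρ.card : ℝ) / ((ρ.card : ℝ) + 1) = 1 / ((ρ.card : ℝ) + 1) := by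
    field_simp
    ring
  have hsr : 2 * (ρ.card : ℝ) + 1 ≤ s := by exact_mod_cast (by omega : 2 * ρ.card + 1 ≤ s)
  obtain ⟨x, hx⟩ : ρ.Nonempty := Finset.card_pos.mp (by omega)
  by_cases hu : ∀ y ∈ ρ, y.1 = x.1
  · obtain ⟨c, hc⟩ := Nat.exists_eq_add_of_le' hρ
    have hκ : 0 < levelFactor H s (c + 3) := levelFactor_pos (by omega) (by omega)
    have hW := SimpleGraph.weightedAdjMatrix_nonneg hw x.1
    have hdeg : 0 ≤ G.weightedDegree w x.1 := Finset.sum_nonneg fun v _ => hW v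
    have hL : 0 ≤ G.weightedDegree w x.1 * (levelFactor H s (c + 3) *
        (((c + 2).factorial : ℝ) * harmonicTail H (c + 3))) := by
      have := harmonicTail_nonneg H (c + 3)
      positivity
    have hb : 0 ≤ levelFactor H s (c + 3) * (c.factorial : ℝ) := by positivity
    have hc0 : (0 : ℝ) < (c : ℝ) + 1 := by positivity
    have hcr : (ρ.card : ℝ) = (c : ℝ) + 1 := by rw [hc]; push_cast; rfl
    refine hasLinkGap_of_product (faceWeight_nonneg hw) faceWeight_of_not_injOn hinj hcardle hbal
      _ (fun b hb b' hb' hne v v' => faceWeight_insert_insert_vertex G w (by omega) hinj hc hu hb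
        hb' hne v v') _ (fun _ => rfl) _ ((ρ.card : ℝ) / ((ρ.card : ℝ) + 1)) ?_ ?_ ?_
    · rw [hcr]
      exact starWeight_form_le hW x.1 hL hb hc0
    · rw [hcr]
      exact le_starWeight_form hW x.1 hL hb hc0
    · rw [hgapnonneg, Fintype.card_fin, one_div_mul_eq_div]
      gcongr
      linarith
  · push Not at hu
    obtain ⟨y, hy, hyx⟩ := hu
    have hadj : G.Adj x.1 y.1 := by
      by_contra h
      exact h0 (faceWeight_of_not_adj hx hy hyx.symm h)
    obtain ⟨i, hi⟩ := Nat.exists_eq_add_of_le' (fiberCard_pos_of_mem hx)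
    obtain ⟨j, hj⟩ := Nat.exists_eq_add_of_le' (fiberCard_pos_of_mem hy)
    have hthree : ∀ z, z ≠ x.1 ∧ z ≠ y.1 → fiberCard ρ z = 0 := by
      intro z hz
      by_contra hf
      obtain ⟨p, hp, rfl⟩ := exists_mem_of_fiberCard_pos (Nat.pos_of_ne_zero hf)
      exact h0 (faceWeight_of_three hx hy hp hyx.symm hz.1.symm hz.2.symm)
    have hc : ρ.card = i + j + 2 := by
      rw [card_eq_sum_fiberCard, Fintype.sum_eq_add x.1 y.1 hyx.symm hthree, hi, hj]
      ring
    have hκ : 0 < levelFactor H s (i + j + 4) := levelFactor_pos (by omega) (by omega)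
    have hWpos : 0 < G.weightedAdjMatrix w x.1 y.1 := by
      rw [SimpleGraph.weightedAdjMatrix_of_adj w hadj]
      exact hw _ hadj
    have hK : 0 < G.weightedAdjMatrix w x.1 y.1 * levelFactor H s (i + j + 4) *
        ((i.factorial : ℝ) * (j.factorial : ℝ)) := by positivity
    have hsum : ∑ v, (fiberCard ρ v : ℝ) = ρ.card := by
      rw [card_eq_sum_fiberCard ρ]; push_cast; rfl
    refine hasLinkGap_of_product (faceWeight_nonneg hw) faceWeight_of_not_injOn hinj hcardle hbal
      _ (fun b hb b' hb' hne v v' => faceWeight_insert_insert_edge G w (by omega) hadj hinj hc hi hj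
        hb hb' hne v v') _ (fun _ => rfl) _ 0 ?_ ?_ ?_
    · rw [← hsum]
      exact urnWeight_form_le (by rw [hsum]; exact_mod_cast hρ) hK
    · intro h
      rw [neg_zero, zero_mul]
      exact urnWeight_form_nonneg (fun v => by positivity) hK.le h
    · rw [hgapnonneg, Fintype.card_fin]
      exact mul_nonneg (by positivity) (by linarith)

end ZComplex

/-! ### From the quadratic form to the matrix of the up-down walk -/

namespace FinComplex

variable {α : Type*} [DecidableEq α]

theorem upDownWalk_mul_weight (X : FinComplex α) (m : Finset α → ℝ)
    (hm : ∀ σ ∈ X.faces, 0 < m σ) (k : ℕ) (σ σ' : X.facesOfDim k) :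
    X.upDownWalk m k σ σ' * m σ' = 1 / ((k : ℝ) + 2) * ∑ τ ∈ X.facesOfDim (k + 1),
      m τ * ((if (σ : Finset α) ⊂ τ then 1 else 0) * if (σ' : Finset α) ⊂ τ then 1 else 0) := by
  have hpos : m σ' ≠ 0 := (hm _ (Finset.mem_filter.mp σ'.2).1).ne'
  rw [upDownWalk, Matrix.mul_apply, Finset.sum_mul, Finset.mul_sum,
    ← Finset.sum_coe_sort (X.facesOfDim (k + 1))]
  refine Finset.sum_congr rfl fun τ _ => ?_
  simp only [downStep, upStep, Matrix.of_apply]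
  split_ifs <;> simp
  field_simp

/-- A sum over the `k`-dimensional faces contained in a face of dimension `k + 1`. -/
theorem sum_facesOfDim_ssubset (X : FinComplex α) {k : ℕ} {τ : Finset α}
    (hτ : τ ∈ X.facesOfDim (k + 1)) (F : Finset α → ℝ) :
    ∑ σ ∈ X.facesOfDim k, (if σ ⊂ τ then 1 else 0) * F σ = ∑ x ∈ τ, F (τ.erase x) := by
  have hτ' := Finset.mem_filter.mp hτ
  rw [← Finset.sum_image (s := τ) (f := F) (g := fun x => τ.erase x)
    (fun x hx y hy hxy => Finset.erase_injOn τ hx hy hxy)]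
  simp only [ite_mul, one_mul, zero_mul]
  rw [← Finset.sum_filter]
  refine Finset.sum_congr ?_ fun _ _ => rfl
  ext σ
  simp only [facesOfDim, facesOfCard, Finset.mem_filter, Finset.mem_image]
  constructor
  · rintro ⟨⟨hσ, hc⟩, hss⟩
    obtain ⟨x, hx, hxσ⟩ := Finset.exists_of_ssubset hss
    refine ⟨x, hx, (Finset.eq_of_subset_of_card_le
      (Finset.subset_erase.mpr ⟨hss.subset, hxσ⟩) ?_).symm⟩
    rw [Finset.card_erase_of_mem hx, hτ'.2, hc]
    omega
  · rintro ⟨x, hx, rfl⟩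
    refine ⟨⟨X.down_closed (Finset.erase_subset _ _) hτ'.1, ?_⟩, Finset.erase_ssubset hx⟩
    rw [Finset.card_erase_of_mem hx, hτ'.2]
    omega

theorem sum_powersetCard_extendWeight [Fintype α] (X : FinComplex α) (m : Finset α → ℝ) (c : ℕ)
    (F : Finset α → ℝ) :
    ∑ σ ∈ Finset.powersetCard c Finset.univ, X.extendWeight m σ * F σ =
      ∑ σ ∈ X.facesOfCard c, m σ * F σ := by
  symm
  rw [show ∑ σ ∈ X.facesOfCard c, m σ * F σ = ∑ σ ∈ X.facesOfCard c, X.extendWeight m σ * F σ from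
    Finset.sum_congr rfl fun σ hσ => by
      rw [extendWeight, if_pos (Finset.mem_filter.mp hσ).1]]
  refine Finset.sum_subset (fun σ hσ => ?_) fun σ hσ hσ' => ?_
  · exact Finset.mem_powersetCard_univ.mpr (Finset.mem_filter.mp hσ).2
  · rw [extendWeight, if_neg, zero_mul]
    exact fun h => hσ' (Finset.mem_filter.mpr ⟨h, Finset.mem_powersetCard_univ.mp hσ⟩)

theorem upDownForm_extendWeight [Fintype α] (X : FinComplex α) (m : Finset α → ℝ) (k : ℕ)
    (F : Finset α → ℝ) :
    upDownForm (X.extendWeight m) (k + 1) F = ∑ τ ∈ X.facesOfDim (k + 1),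
      m τ * (∑ σ : X.facesOfDim k, (if (σ : Finset α) ⊂ τ then 1 else 0) * F σ) ^ 2 := by
  rw [upDownForm, X.sum_powersetCard_extendWeight m (k + 1 + 1)
    fun τ => (∑ x ∈ τ, F (τ.erase x)) ^ 2]
  refine Finset.sum_congr rfl fun τ hτ => ?_
  rw [← X.sum_facesOfDim_ssubset hτ F,
    ← Finset.sum_coe_sort (X.facesOfDim k) fun σ => (if σ ⊂ τ then 1 else 0) * F σ]

/-- A Poincaré inequality for the up-down form bounds the second eigenvalue of the up-down walk. -/
theorem secondEigenvalue_upDownWalk_le [Fintype α] (X : FinComplex α) (m : Finset α → ℝ)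
    (hm : ∀ σ ∈ X.faces, 0 < m σ) {k : ℕ} {γ : ℝ} (hcard : 2 ≤ (X.facesOfDim k).card)
    (hgap : HasUpDownGap (X.extendWeight m) (k + 1) γ) :
    secondEigenvalue (X.upDownWalk m k) ≤ 1 - γ := by
  have hsymm : ∀ σ σ' : X.facesOfDim k,
      X.upDownWalk m k σ σ' * m σ' = X.upDownWalk m k σ' σ * m σ := by
    intro σ σ'
    rw [X.upDownWalk_mul_weight m hm, X.upDownWalk_mul_weight m hm]
    congr 1
    exact Finset.sum_congr rfl fun τ _ => by ring
  apply secondEigenvalue_le (X.upDownWalk m k) (fun σ => m σ)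
    (fun σ => hm _ (Finset.mem_filter.mp σ.2).1) hsymm (by rwa [Fintype.card_coe])
  intro f hf
  set F : Finset α → ℝ := fun σ => if h : σ ∈ X.facesOfDim k then f ⟨σ, h⟩ else 0 with hF
  have hfF : ∀ σ : X.facesOfDim k, f σ = F σ := fun σ => by
    rw [hF]; simp
  have hsub : ∀ g : Finset α → ℝ, ∑ σ : X.facesOfDim k, m σ * g σ =
      ∑ σ ∈ Finset.powersetCard (k + 1) Finset.univ, X.extendWeight m σ * g σ := fun g => by
    rw [X.sum_powersetCard_extendWeight m]
    exact Finset.sum_coe_sort (X.facesOfDim k) fun σ => m σ * g σ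
  simp only [hfF] at hf ⊢
  rw [hsub] at hf
  rw [hsub fun σ => F σ ^ 2]
  have h1 := hgap F hf
  have h2 : ∑ σ : X.facesOfDim k, ∑ σ' : X.facesOfDim k,
      X.upDownWalk m k σ σ' * m σ' * F σ * F σ' =
      1 / ((k : ℝ) + 2) * upDownForm (X.extendWeight m) (k + 1) F := by
    rw [X.upDownForm_extendWeight]
    simp only [X.upDownWalk_mul_weight m hm, sq, Finset.mul_sum,
      Finset.sum_mul]
    rw [Finset.sum_congr rfl fun _ _ => Finset.sum_comm, Finset.sum_comm]
    refine Finset.sum_congr rfl fun τ _ => Finset.sum_congr rfl fun σ _ =>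
      Finset.sum_congr rfl fun σ' _ => ?_
    ring
  rw [h2]
  have hk : (0 : ℝ) < (k : ℝ) + 2 := by positivity
  rw [one_div_mul_eq_div, div_le_iff₀ hk]
  push_cast at h1
  linarith

end FinComplex

/-! ### The random walk on `G` -/

namespace SimpleGraph

variable {V : Type*} [Fintype V]

theorem weightedDegree_pos {G : SimpleGraph V} {w : Sym2 V → ℝ} (hw : ∀ e ∈ G.edgeSet, 0 < w e)
    (hG : G.Connected) (hn : 2 ≤ Fintype.card V) (v : V) : 0 < G.weightedDegree w v := by
  obtain ⟨u, hu⟩ := Fintype.exists_ne_of_one_lt_card hn v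
  obtain ⟨x, hx⟩ := (hG.preconnected v u).nonempty_neighborSet_left hu.symm
  refine Finset.sum_pos' (fun u _ => weightedAdjMatrix_nonneg hw v u) ⟨x, Finset.mem_univ _, ?_⟩
  rw [weightedAdjMatrix_of_adj w hx]
  exact hw _ hx

theorem neg_le_weightedAdjMatrix_form {G : SimpleGraph V} {w : Sym2 V → ℝ}
    (hw : ∀ e ∈ G.edgeSet, 0 < w e) (h : V → ℝ) :
    -∑ x, G.weightedDegree w x * h x ^ 2 ≤
      ∑ x, ∑ y, G.weightedAdjMatrix w x y * h x * h y := by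
  have h1 : ∑ x, ∑ y, G.weightedAdjMatrix w x y * h x ^ 2 =
      ∑ x, G.weightedDegree w x * h x ^ 2 :=
    Finset.sum_congr rfl fun x _ => by rw [weightedDegree, Finset.sum_mul]
  have h2 : ∑ x, ∑ y, G.weightedAdjMatrix w x y * h y ^ 2 =
      ∑ x, G.weightedDegree w x * h x ^ 2 := by
    rw [Finset.sum_comm, ← h1]
    exact Finset.sum_congr rfl fun x _ => Finset.sum_congr rfl fun y _ => by
      rw [G.weightedAdjMatrix_comm]
  have h3 : 0 ≤ ∑ x, ∑ y, G.weightedAdjMatrix w x y * (h x + h y) ^ 2 :=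
    Finset.sum_nonneg fun x _ => Finset.sum_nonneg fun y _ =>
      mul_nonneg (weightedAdjMatrix_nonneg hw x y) (sq_nonneg _)
  have e : ∀ x y, G.weightedAdjMatrix w x y * (h x + h y) ^ 2 =
      G.weightedAdjMatrix w x y * h x ^ 2 + G.weightedAdjMatrix w x y * h y ^ 2 +
        2 * (G.weightedAdjMatrix w x y * h x * h y) := fun x y => by ring
  simp only [e, Finset.sum_add_distrib, ← Finset.mul_sum, h1, h2] at h3
  linarith

variable [DecidableEq V]

theorem walkMatrix_mul_weightedDegree {G : SimpleGraph V} {w : Sym2 V → ℝ}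
    (hdeg : ∀ v, 0 < G.weightedDegree w v) (u v : V) :
    G.walkMatrix w u v * G.weightedDegree w v = G.weightedAdjMatrix w u v := by
  have hD : G.weightedDegMatrix w = Matrix.diagonal (G.weightedDegree w) := by
    rw [weightedDegMatrix]
    congr 1
    ext v
    exact Finset.sum_congr rfl fun u _ => G.weightedAdjMatrix_comm w u v
  have hdet : IsUnit (Matrix.diagonal (G.weightedDegree w)).det := by
    rw [Matrix.det_diagonal, isUnit_iff_ne_zero]
    exact Finset.prod_ne_zero_iff.mpr fun v _ => (hdeg v).ne'
  have h := congrFun (congrFun (Matrix.nonsing_inv_mul_cancel_right _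
    (G.weightedAdjMatrix w) hdet) u) v
  rwa [Matrix.mul_diagonal, ← hD] at h

theorem sum_walkMatrix {G : SimpleGraph V} {w : Sym2 V → ℝ}
    (hdeg : ∀ v, 0 < G.weightedDegree w v) (v : V) : ∑ u, G.walkMatrix w u v = 1 := by
  refine mul_right_cancel₀ (hdeg v).ne' ?_
  simp only [Finset.sum_mul, walkMatrix_mul_weightedDegree hdeg, one_mul]
  exact Finset.sum_congr rfl fun u _ => G.weightedAdjMatrix_comm w u v

theorem weightedAdjMatrix_form_le {G : SimpleGraph V} {w : Sym2 V → ℝ}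
    (hw : ∀ e ∈ G.edgeSet, 0 < w e) (hdeg : ∀ v, 0 < G.weightedDegree w v)
    (hn : 2 ≤ Fintype.card V) (h : V → ℝ) (hh : ∑ x, G.weightedDegree w x * h x = 0) :
    ∑ x, ∑ y, G.weightedAdjMatrix w x y * h x * h y ≤
      (1 - spectralGap (G.walkMatrix w)) * ∑ x, G.weightedDegree w x * h x ^ 2 := by
  have key := quadratic_form_le_secondEigenvalue (G.walkMatrix w) (G.weightedDegree w) hdeg
    (fun i j => by
      rw [walkMatrix_mul_weightedDegree hdeg]
      exact weightedAdjMatrix_nonneg hw i j)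
    (fun i j => by
      rw [walkMatrix_mul_weightedDegree hdeg, walkMatrix_mul_weightedDegree hdeg,
        G.weightedAdjMatrix_comm])
    (sum_walkMatrix hdeg) hn h hh
  simp only [walkMatrix_mul_weightedDegree hdeg] at key
  rwa [spectralGap, sub_sub_cancel]

theorem spectralGap_walkMatrix_nonneg {G : SimpleGraph V} {w : Sym2 V → ℝ}
    (hw : ∀ e ∈ G.edgeSet, 0 < w e) (hdeg : ∀ v, 0 < G.weightedDegree w v)
    (hn : 2 ≤ Fintype.card V) : 0 ≤ spectralGap (G.walkMatrix w) := by
  rw [spectralGap, sub_nonneg]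
  refine secondEigenvalue_le_one_of_stochastic (G.walkMatrix w) (G.weightedDegree w) hdeg
    (fun i j => ?_) (fun i j => ?_) (sum_walkMatrix hdeg) hn
  · rw [walkMatrix_mul_weightedDegree hdeg]
    exact weightedAdjMatrix_nonneg hw i j
  · rw [walkMatrix_mul_weightedDegree hdeg, walkMatrix_mul_weightedDegree hdeg,
      G.weightedAdjMatrix_comm]

/-- The gap of a graph with at least four vertices is at most `4 / 3`, as the indicator of a vertex
of least degree shows. -/
theorem spectralGap_walkMatrix_le {G : SimpleGraph V} {w : Sym2 V → ℝ}
    (hw : ∀ e ∈ G.edgeSet, 0 < w e) (hdeg : ∀ v, 0 < G.weightedDegree w v)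
    (hn : 4 ≤ Fintype.card V) : spectralGap (G.walkMatrix w) ≤ 4 / 3 := by
  have : Nonempty V := Fintype.card_pos_iff.mp (by omega)
  obtain ⟨v, -, hv⟩ := Finset.exists_min_image Finset.univ (G.weightedDegree w)
    Finset.univ_nonempty
  set δ := G.weightedDegree w v with hδ
  set D := ∑ x, G.weightedDegree w x with hD
  have hδ0 : 0 < δ := hdeg v
  have hD4 : 4 * δ ≤ D := by
    have h1 : (Fintype.card V : ℝ) * δ ≤ D := by
      have := Finset.card_nsmul_le_sum Finset.univ (G.weightedDegree w) δ hv
      rwa [Finset.card_univ, nsmul_eq_mul] at this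
    have h2 : (4 : ℝ) ≤ Fintype.card V := by exact_mod_cast hn
    nlinarith
  -- the indicator of `v`, scaled by `D` and shifted to have mean zero
  have hsum : ∀ g : V → ℝ, ∑ x, g x * ((if x = v then D else 0) - δ) =
      g v * D - δ * ∑ x, g x := by
    intro g
    simp only [mul_sub, Finset.sum_sub_distrib, mul_ite, mul_zero, Finset.sum_ite_eq',
      Finset.mem_univ, if_true, ← Finset.sum_mul]
    ring
  have hcol : ∑ x, G.weightedAdjMatrix w x v = δ :=
    Finset.sum_congr rfl fun x _ => G.weightedAdjMatrix_comm w x v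
  have key := weightedAdjMatrix_form_le hw hdeg (by omega)
    (fun x => (if x = v then D else 0) - δ) (by rw [hsum, ← hD, ← hδ]; ring)
  have e1 : ∑ x, G.weightedDegree w x * ((if x = v then D else 0) - δ) ^ 2 = δ * D * (D - δ) := by
    have := hsum fun x => G.weightedDegree w x * ((if x = v then D else 0) - δ)
    simp only [mul_assoc, ← sq] at this
    rw [this, hsum, ← hD, ← hδ, if_true]
    ring
  have e2 : ∑ x, ∑ y, G.weightedAdjMatrix w x y * ((if x = v then D else 0) - δ) *
      ((if y = v then D else 0) - δ) = -(δ ^ 2 * D) := by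
    have hx : ∀ x, ∑ y, G.weightedAdjMatrix w x y * ((if x = v then D else 0) - δ) *
        ((if y = v then D else 0) - δ) = (G.weightedAdjMatrix w x v * D -
          δ * G.weightedDegree w x) * ((if x = v then D else 0) - δ) := by
      intro x
      rw [hsum fun y => G.weightedAdjMatrix w x y * ((if x = v then D else 0) - δ),
        ← Finset.sum_mul]
      change _ - δ * (G.weightedDegree w x * _) = _
      ring
    simp only [hx]
    rw [hsum, Finset.sum_sub_distrib, ← Finset.sum_mul, ← Finset.mul_sum, hcol, ← hD, ← hδ,
      G.weightedAdjMatrix_self]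
    ring
  rw [e1, e2] at key
  have hDpos : 0 < D := by linarith
  have h1 : δ * D * (-δ) ≤ δ * D * ((1 - spectralGap (G.walkMatrix w)) * (D - δ)) := by linarith
  have h2 := le_of_mul_le_mul_left h1 (mul_pos hδ0 hDpos)
  by_contra hcon
  push Not at hcon
  nlinarith

end SimpleGraph

/-! ### The gap of the walks on `Z` -/

namespace ZComplex

variable {V : Type*} [Fintype V] [DecidableEq V]

theorem harmonicTail_one (H : ℕ) :
    harmonicTail H 1 = ∑ l ∈ Finset.Icc 1 H, 1 / (l : ℝ) := rfl

theorem three_halves_le_harmonicTail {H : ℕ} (hH : 2 ≤ H) : 3 / 2 ≤ harmonicTail H 1 := by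
  rw [harmonicTail_of_le (by omega), harmonicTail_of_le (by omega : 1 + 1 ≤ H)]
  have := harmonicTail_nonneg H (1 + 1 + 1)
  norm_num at this ⊢
  linarith

/-- The gap of the link of the empty face. The laziness of the walk costs the harmonic factor; the
bounds on `n`, `H` and `s` make the bottom of the spectrum harmless. -/
theorem hasLinkGap_empty {G : SimpleGraph V} {w : Sym2 V → ℝ}
    (hw : ∀ e ∈ G.edgeSet, 0 < w e) (hdeg : ∀ v, 0 < G.weightedDegree w v)
    (hn : 4 ≤ Fintype.card V) {H s : ℕ} (hH : 2 ≤ H) (hs : 2 * H ≤ s) :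
    HasLinkGap (faceWeight G w H s) ∅ (spectralGap (G.walkMatrix w) / harmonicTail H 1) := by
  have hκ : 0 < levelFactor H s 2 := levelFactor_pos (by omega) (by omega)
  have hS := three_halves_le_harmonicTail hH
  set S := harmonicTail H 1 with hSdef
  have hS2 : harmonicTail H 2 = S - 1 := by
    rw [hSdef, harmonicTail_of_le (by omega : 1 ≤ H)]
    norm_num
  have hlk : levelFactor H s 2 * harmonicTail H 2 + levelFactor H s 2 = levelFactor H s 2 * S := by
    rw [hS2]; ring
  have hratio : levelFactor H s 2 / (levelFactor H s 2 * harmonicTail H 2 + levelFactor H s 2) =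
      1 / S := by
    rw [hlk]; field_simp
  have hlk0 : 0 < levelFactor H s 2 * harmonicTail H 2 + levelFactor H s 2 := by
    rw [hlk]; positivity
  have hd : ∀ x, (levelFactor H s 2 * harmonicTail H 2 + levelFactor H s 2) *
      G.weightedDegree w x = ∑ y, ((if x = y then
        levelFactor H s 2 * harmonicTail H 2 * G.weightedDegree w x else 0) +
        levelFactor H s 2 * G.weightedAdjMatrix w x y) := by
    intro x
    simp only [Finset.sum_add_distrib, Finset.sum_ite_eq, Finset.mem_univ, if_true,
      ← Finset.mul_sum]
    rw [← SimpleGraph.weightedDegree]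
    ring
  have hν : spectralGap (G.walkMatrix w) / S = levelFactor H s 2 /
      (levelFactor H s 2 * harmonicTail H 2 + levelFactor H s 2) *
        spectralGap (G.walkMatrix w) := by
    rw [hratio]; ring
  refine hasLinkGap_of_product (faceWeight_nonneg hw) faceWeight_of_not_injOn (by simp)
    (by rw [Fintype.card_fin, Finset.card_empty]; omega)
    (fun y _ => faceWeight_eq_sum G w _ (by simp; omega)) _
    (fun b _ b' _ hne v v' => faceWeight_pair G w hH hne v v') _ hd _
    ((levelFactor H s 2 - levelFactor H s 2 * harmonicTail H 2) /
      (levelFactor H s 2 * harmonicTail H 2 + levelFactor H s 2)) ?_ ?_ ?_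
  · rw [hν]
    exact fun h hh => lazy_form_le (fun x y => G.weightedAdjMatrix w x y) (G.weightedDegree w)
      hκ.le hlk0 (SimpleGraph.weightedAdjMatrix_form_le hw hdeg (by omega)) h hh
  · exact le_lazy_form (fun x y => G.weightedAdjMatrix w x y) (G.weightedDegree w) hκ.le hlk0
      (SimpleGraph.neg_le_weightedAdjMatrix_form hw)
  · have hgap := SimpleGraph.spectralGap_walkMatrix_le hw hdeg hn
    have hs4 : (4 : ℝ) ≤ s := by exact_mod_cast (by omega : 4 ≤ s)
    have hSpos : 0 < S := by linarith
    have hβ : (levelFactor H s 2 - levelFactor H s 2 * harmonicTail H 2) /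
        (levelFactor H s 2 * harmonicTail H 2 + levelFactor H s 2) = 2 / S - 1 := by
      rw [hlk, hS2]
      field_simp
      ring
    have hinv : 1 / S ≤ 2 / 3 := by
      rw [div_le_div_iff₀ hSpos (by norm_num)]; linarith
    have h1 : spectralGap (G.walkMatrix w) / S ≤ 4 / 3 * (1 / S) := by
      rw [div_eq_mul_one_div]
      exact mul_le_mul_of_nonneg_right hgap (by positivity)
    have h2 : 2 / S = 2 * (1 / S) := by ring
    rw [hβ, Fintype.card_fin, Finset.card_empty, h2]
    push_cast
    nlinarith

theorem two_le_card_facesOfDim {G : SimpleGraph V} {w : Sym2 V → ℝ}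
    (hdeg : ∀ v, 0 < G.weightedDegree w v) (hn : 2 ≤ Fintype.card V) {H s k : ℕ} (hs : H < s)
    (hk : k + 1 ≤ H) : 2 ≤ ((complex G H s).facesOfDim k).card := by
  obtain ⟨u, v, huv⟩ := Fintype.one_lt_card_iff.mp (show 1 < Fintype.card V by omega)
  -- the `k + 1` copies of a vertex with the least colours
  let e : V → Fin (k + 1) ↪ V × Fin s := fun z =>
    ⟨fun b => (z, Fin.castLE (by omega) b), fun b b' h => by simpa using h⟩
  have hmem : ∀ z, Finset.univ.map (e z) ∈ (complex G H s).facesOfDim k := by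
    intro z
    have hc : (Finset.univ.map (e z)).card = k + 1 := by simp
    refine Finset.mem_filter.mpr ⟨mem_faces_of_faceWeight_ne_zero (w := w) ?_, hc⟩
    rw [faceWeight_vertex G w (c := k) (by omega) ?_ hc (u := z) fun x hx => by
      obtain ⟨b, -, rfl⟩ := Finset.mem_map.mp hx
      rfl]
    · have h1 := hdeg z
      have h2 : 0 < levelFactor H s (k + 1) := levelFactor_pos hs (by omega)
      have h3 : 0 < harmonicTail H (k + 1) := by
        rw [harmonicTail_of_le hk]
        have := harmonicTail_nonneg H (k + 1 + 1)
        positivity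
      positivity
    · intro x hx y hy hxy
      simp only [Finset.coe_map, Finset.coe_univ, Set.image_univ, Set.mem_range] at hx hy
      obtain ⟨b, rfl⟩ := hx
      obtain ⟨b', rfl⟩ := hy
      exact Prod.ext rfl hxy
  refine Finset.one_lt_card.mpr ⟨_, hmem u, _, hmem v, fun h => huv ?_⟩
  have h0 : e u 0 ∈ Finset.univ.map (e v) := by rw [← h]; simp
  obtain ⟨b, -, hb⟩ := Finset.mem_map.mp h0
  exact (congrArg Prod.fst hb).symm

/-- Multiplying the gaps of the links, which telescope from the links of vertices on. -/
theorem hasUpDownGap_faceWeight {G : SimpleGraph V} {w : Sym2 V → ℝ}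
    (hw : ∀ e ∈ G.edgeSet, 0 < w e) (hdeg : ∀ v, 0 < G.weightedDegree w v)
    (hn : 4 ≤ Fintype.card V) {H s : ℕ} (hH : 2 ≤ H) (hs : 2 * H ≤ s) {k : ℕ} (hk : k + 1 ≤ H) :
    HasUpDownGap (faceWeight G w H s) (k + 1)
      (spectralGap (G.walkMatrix w) / harmonicTail H 1 / (((k : ℝ) + 2) * ((k : ℝ) + 1))) := by
  have hS := three_halves_le_harmonicTail hH
  have hν0 : 0 ≤ spectralGap (G.walkMatrix w) / harmonicTail H 1 :=
    div_nonneg (SimpleGraph.spectralGap_walkMatrix_nonneg hw hdeg (by omega)) (by linarith)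
  have hν1 : spectralGap (G.walkMatrix w) / harmonicTail H 1 ≤ 1 := by
    rw [div_le_one (by linarith)]
    linarith [SimpleGraph.spectralGap_walkMatrix_le hw hdeg hn]
  set ν := spectralGap (G.walkMatrix w) / harmonicTail H 1 with hν
  have hbal : ∀ σ : Finset (V × Fin s), σ.card ≤ H → faceWeight G w H s σ =
      ∑ x ∈ σᶜ, faceWeight G w H s (insert x σ) := fun σ hσ => faceWeight_eq_sum G w σ hσ
  induction k with
  | zero =>
    have h0 := hasUpDownGap_zero (faceWeight G w H s) (by
      have := hbal ∅ (by simp)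
      simpa using this)
    have h1 := h0.succ le_rfl hν0 (faceWeight_nonneg hw) (fun σ hσ => hbal σ (by omega))
      fun ρ hρ => by
        rw [Finset.card_eq_zero.mp hρ]
        exact hasLinkGap_empty hw hdeg hn hH hs
    convert h1 using 1
    norm_num
    ring
  | succ k ih =>
    have h1 := (ih (by omega)).succ (ν := ((k : ℝ) + 1) / ((k : ℝ) + 2)) (by
        refine div_le_one_of_le₀ (hν1.trans ?_) (by positivity)
        have : (0 : ℝ) ≤ k := by positivity
        nlinarith) (by positivity) (faceWeight_nonneg hw) (fun σ hσ => hbal σ (by omega))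
      fun ρ hρ => by
        have := hasLinkGap_of_nonempty hw hs (ρ := ρ) (by omega) (by omega)
        rw [hρ] at this
        convert this using 1
        push_cast
        ring
    convert h1 using 1
    push_cast
    field_simp
    ring

end ZComplex

theorem mainTheorem1 {V : Type*} [Fintype V] [DecidableEq V]
    (G : SimpleGraph V) (w : Sym2 V → ℝ) (hw : ∀ e ∈ G.edgeSet, 0 < w e)
    (hG : G.Connected) (hn : 4 ≤ Fintype.card V)
    (H s : ℕ) (hH : 2 ≤ H) (hs : 2 * H ≤ s) (k : ℕ) (hk : k ≤ H - 1) :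
    spectralGap ((ZComplex.complex G H s).upDownWalk (ZComplex.weight G w H s) k) ≥
        spectralGap (G.walkMatrix w) /
          ((∑ l ∈ Finset.Icc 1 H, 1 / (l : ℝ)) * ((k : ℝ) + 2) * ((k : ℝ) + 1)) ∧
      spectralGap (G.walkMatrix w) /
          ((∑ l ∈ Finset.Icc 1 H, 1 / (l : ℝ)) * ((k : ℝ) + 2) * ((k : ℝ) + 1)) ≥
        spectralGap (G.walkMatrix w) /
          ((1 + Real.log H) * ((k : ℝ) + 2) * ((k : ℝ) + 1)) := by
  have hdeg := SimpleGraph.weightedDegree_pos hw hG (by omega)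
  constructor
  · have h1 := FinComplex.secondEigenvalue_upDownWalk_le (ZComplex.complex G H s)
      (ZComplex.weight G w H s) (fun σ hσ => ZComplex.weight_pos hw hσ)
      (ZComplex.two_le_card_facesOfDim hdeg (by omega) (by omega) (by omega))
      (ZComplex.hasUpDownGap_faceWeight hw hdeg hn hH hs (k := k) (by omega))
    rw [← ZComplex.harmonicTail_one, mul_assoc, ← div_div, spectralGap, ge_iff_le]
    linarith
  · have hlog : ∑ l ∈ Finset.Icc 1 H, 1 / (l : ℝ) ≤ 1 + Real.log H := by
      have := harmonic_le_one_add_log H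
      rw [harmonic_eq_sum_Icc] at this
      push_cast at this
      simpa only [one_div] using this
    have hS := ZComplex.three_halves_le_harmonicTail hH
    rw [ZComplex.harmonicTail_one] at hS
    have hgap := SimpleGraph.spectralGap_walkMatrix_nonneg hw hdeg (by omega)
    rw [ge_iff_le]
    gcongr
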